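/- **Theorem 2.2** (Correspondence principle for weakly stable sets). *Conventions.* $\mathbb{N}=\{1,2,\dots\}$. For $A\subset\mathbb{N}$ let $d_-(A)=\liminf_{x\to\infty}|A\cap[1,x]|/x$ and let $d(A)=\lim_{x\to\infty}|A\cap[1,x]|/x$ when this limit exists; for $h\in\mathbb{Z}$ let $A-h=\{n\in\mathbb{N}: n+h\in A\}$. We write $\mathbb{E}_{n\in S}$ for the average over a finite nonempty set $S$, and $$\mathbb{E}^{\log}_{p\le P}f(p)=\Big(\sum_{p\le P}\tfrac{f(p)}{p}\Big)\Big/\Big(\sum_{p\le P}\tfrac1p\Big)$$ for the logarithmic average over the primes $p\le P$. A set $A\subset\mathbb{N}$ is *weakly stable* if for every $x\ge 1$ there is a set $B_x\subset\mathbb{N}$ such that for every prime $p$ $$\lim_{x\to\infty}\mathbb{E}_{n\le x,\ p\nmid n}|1_A(n)-1_{B_x}(pn)|=0 .$$ A set $A\subset\mathbb{N}$ is *uniformly distributed in short intervals with density* $\delta$ if for all $b,q\in\mathbb{N}$ $$\lim_{H\to\infty}\limsup_{x\to\infty}\frac1x\int_0^x\left|\frac{|A\cap[y,y+H]\cap(q\mathbb{Z}+b)|}{H}-\frac{\delta}{q}\right|dy=0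 .$$ A *separable measure-preserving system* $(X,\mathcal{X},\mu,T)$ consists of a probability space $(X,\mathcal{X},\mu)$ whose $\sigma$-algebra $\mathcal{X}$ is countably generated and an invertible map $T:X\to X$ with $T,T^{-1}$ measurable and $\mu(T^{-1}E)=\mu(E)$ for all $E\in\mathcal{X}$. *Theorem.* Let $A_1,\dots,A_k\subset\mathbb{N}$ be weakly stable sets. Suppose that there is a finite index set $I$ and, for each $\alpha\in I$, a natural number $m^\alpha$, integers $h_1^\alpha,\dots,h_{m^\alpha}^\alpha$ and indices $c_1^\alpha,\dots,c_{m^\alpha}^\alpha\in\{1,\dots,k\}$ such that $$d_-\Big(\bigcup_{\alpha\in I}\bigcap_{i=1}^{m^\alpha}(A_{c_i^\alpha}-h_i^\alpha)\Big)=0 .$$ Then there exist a separable measure-preserving system $(X,\mathcal{X},\mu,T)$ and measurable sets $B_1,\dots,B_k\in\mathcal{X}$ such that $$\lim_{P\to\infty}\sum_{\alpha\in I}\mathbb{E}^{\log}_{p\le P}\int_X\prod_{i=1}^{m^\alpha}1_{B_{c_i^\alpha}}(T^{ph_i^\alpha}x)\,d\mu(x)=0,$$ and such that, in addition, all of the following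 hold. (i) If for each $j=1,\dots,k$ the set $A_j$ is uniformly distributed in short intervals with density $\delta_j\in[0,1]$, then for every natural number $q$ and every $j=1,\dots,k$ $$\lim_{H\to\infty}\int_X\Big|\mathbb{E}_{t\le H}1_{B_j}(T^{qt}x)-\delta_j\Big|\,d\mu(x)=0 ;$$ in particular $\mu(B_j)=\delta_j$ for each $j$. (ii) If $d(A_i\cap A_j)=0$ for all $i\ne j$, then $\mu(B_i\cap B_j)=0$ for all $i\ne j$. (iii) If $d\big(\bigcup_{j=1}^kA_j\big)=1$, then $\bigcup_{j=1}^kB_j$ has full measure. -/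

import Mathlib

open MeasureTheory Filter Topology
open scoped BigOperators

noncomputable section

namespace WeakStable

/-- The indicator function `1_S`, real valued. -/
def ind {Y : Type*} (S : Set Y) (y : Y) : ℝ := S.indicator (fun _ => (1 : ℝ)) y

/-- `|S ∩ [1, x]| / x`. -/
def densityUpTo (S : Set ℕ) (x : ℝ) : ℝ :=
  ((S ∩ {n : ℕ | 1 ≤ n ∧ (n : ℝ) ≤ x}).ncard : ℝ) / x

/-- The lower density `d_-(S) = liminf_{x → ∞} |S ∩ [1, x]| / x`. -/
def lowerDensity (S : Set ℕ) : ℝ := liminf (densityUpTo S) atTop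

/-- `S` has asymptotic density `d`: the limit of `|S ∩ [1, x]| / x` exists and equals `d`. -/
def HasDensity (S : Set ℕ) (d : ℝ) : Prop := Tendsto (densityUpTo S) atTop (𝓝 d)

/-- The shift `A - h = {n : n + h ∈ A}` of a set of natural numbers by an integer `h`
(as a set of natural numbers). -/
def shift (A : Set ℕ) (h : ℤ) : Set ℕ := {n : ℕ | ∃ a ∈ A, (a : ℤ) = (n : ℤ) + h}

/-- The sets `B x` (for `x ≥ 1`) correspond to `A`: for every prime `p`, the average of
`|1_A(n) - 1_{B x}(p n)|` over `1 ≤ n ≤ x` with `p ∤ n` tends to `0` as `x → ∞`. -/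
def Corresponds (B : ℝ → Set ℕ) (A : Set ℕ) : Prop :=
  ∀ p : ℕ, p.Prime →
    Tendsto (fun x : ℝ =>
      Finset.expect ((Finset.Icc 1 ⌊x⌋₊).filter (fun n => ¬ p ∣ n))
        (fun n => |ind A n - ind (B x) (p * n)|)) atTop (𝓝 0)

/-- Weakly stable sets of natural numbers. -/
def WeaklyStable (A : Set ℕ) : Prop := ∃ B : ℝ → Set ℕ, Corresponds B A

/-- `A` is uniformly distributed in short intervals with asymptotic density `δ`:
`lim_{H → ∞} limsup_{x → ∞} (1/x) ∫_0^x | |A ∩ [y, y+H] ∩ (qℤ+b)| / H - δ/q | dy = 0`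
for all natural numbers `b` and all natural numbers `q ≥ 1`. -/
def UniformInShortIntervals (A : Set ℕ) (δ : ℝ) : Prop :=
  ∀ b q : ℕ, 1 ≤ q →
    Tendsto (fun H : ℝ =>
      limsup (fun x : ℝ =>
        (1 / x) * ∫ y in (0 : ℝ)..x,
          |((A ∩ {n : ℕ | y ≤ (n : ℝ) ∧ (n : ℝ) ≤ y + H ∧ n ≡ b [MOD q]}).ncard : ℝ) / H
            - δ / q|) atTop) atTop (𝓝 0)

/-- The logarithmic average over the primes `p ≤ P` :
`(∑_{p ≤ P} f(p)/p) / (∑_{p ≤ P} 1/p)`. -/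
def primeLogAvg (P : ℕ) (f : ℕ → ℝ) : ℝ :=
  (∑ p ∈ (Finset.Icc 1 P).filter Nat.Prime, f p / p) /
    (∑ p ∈ (Finset.Icc 1 P).filter Nat.Prime, 1 / (p : ℝ))

/-- `(X, μ, T)` is a separable (probability) measure-preserving system: `T` is an invertible
map, measurable together with its inverse, it preserves the probability measure `μ`, and the
sigma algebra of `X` is countably generated. -/
structure IsSeparableSystem {X : Type*} [MeasurableSpace X] (μ : Measure X)
    (T : Equiv.Perm X) : Prop where
  isProbabilityMeasure : IsProbabilityMeasure μ
  measurePreserving : MeasurePreserving T μ μ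
  measurable_symm : Measurable T.symm
  countablyGenerated : MeasurableSpace.CountablyGenerated X

end WeakStable

end

/-!
The measure-preserving system is the space of two-sided sequences of letters in `Fin k → Bool` with
the shift. Its measure is the distribution, for a random `n ≤ x` and in the limit along an
ultrafilter `U` in `x`, of the membership of `n + i` in the sets `B j x` that correspond to the
weakly stable sets `A j`. The ultrafilter is chosen such that the union in the hypothesis has
density zero along it. Everything about the limit is phrased with a finitely additive mean `M` on
the functions of `(x, n)`; the Riesz–Markov–Kakutani theorem converts `M` into the measure
(`exists_measure_of_mean`).

Weak stability says that, on the multiples of `p`, the letters of `B x` at `n + p h` are those of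
`A` at `n / p + h`, up to density zero and the multiples of `p ^ 2` (`limMean_pattern_le`). As `p` is fixed
while `x` tends to infinity, the bound `n ≤ x` may be used for `n / p`, so the hypothesis shows that
the mean of `1_{p ∣ n} ∏ 1_B(n + p h i)` is `O(1 / p ^ 2)`. Two devices remove the restriction to
the multiples of `p`.

* If the shifts do not depend on `p`, the Turán–Kubilius inequality allows one to replace `1` by the
  normalised number of prime divisors of `n` in a finite set of primes. This gives disjointness and
  covering (`mean_eq_zero_of_primes`) and, applied to averages along progressions, uniform
  distribution (`tendsto_mean_abs_avg`, `tendsto_limMean_progression`).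

* For the shifts `p h i`, Tao's entropy decrement argument is used
  (`tendsto_primeLogAvg_pattern`). For a word of length proportional to the dyadic scale of `p`, the
  error of replacing `p 1_{p ∣ n}` by `1` is bounded through the Gibbs variational principle by the
  decrease of the conditional entropy of the word when the residue modulo `p` is added to the
  residues modulo the smaller primes (`mul_mean_le_condEnt_sub`). By subadditivity the decreases are
  summable against `1 / p` (`sum_condEnt_drop_le`), while `∑ 1 / p` diverges, so the logarithmic
  average of the error tends to zero.
-/

namespace WeakStable

/-! ### Finitely additive means -/

/-- A real function is bounded in absolute value. -/
def Bdd {Ω : Type*} (f : Ω → ℝ) : Prop := ∃ C, ∀ ω, |f ω| ≤ C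

namespace Bdd

variable {Ω : Type*} {f g : Ω → ℝ}

lemma const (c : ℝ) : Bdd (fun _ : Ω => c) := ⟨|c|, fun _ => le_rfl⟩

lemma of_mem_Icc (hf : ∀ ω, f ω ∈ Set.Icc (0 : ℝ) 1) : Bdd f :=
  ⟨1, fun ω => by rw [abs_of_nonneg (hf ω).1]; exact (hf ω).2⟩

lemma ite (p : Ω → Prop) [DecidablePred p] : Bdd (fun ω => if p ω then (1 : ℝ) else 0) :=
  of_mem_Icc fun ω => by split_ifs <;> simp

lemma add (hf : Bdd f) (hg : Bdd g) : Bdd (fun ω => f ω + g ω) := by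
  obtain ⟨C, hC⟩ := hf
  obtain ⟨D, hD⟩ := hg
  exact ⟨C + D, fun ω => (abs_add_le _ _).trans (add_le_add (hC ω) (hD ω))⟩

lemma mul (hf : Bdd f) (hg : Bdd g) : Bdd (fun ω => f ω * g ω) := by
  obtain ⟨C, hC⟩ := hf
  obtain ⟨D, hD⟩ := hg
  refine ⟨C * D, fun ω => ?_⟩
  rw [abs_mul]
  exact mul_le_mul (hC ω) (hD ω) (abs_nonneg _) ((abs_nonneg _).trans (hC ω))

lemma const_mul (c : ℝ) (hf : Bdd f) : Bdd (fun ω => c * f ω) := (const c).mul hf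

lemma sub (hf : Bdd f) (hg : Bdd g) : Bdd (fun ω => f ω - g ω) := by
  have := hf.add (hg.const_mul (-1))
  simpa [sub_eq_add_neg] using this

lemma abs (hf : Bdd f) : Bdd (fun ω => |f ω|) := by
  obtain ⟨C, hC⟩ := hf
  exact ⟨C, fun ω => by rw [abs_abs]; exact hC ω⟩

lemma comp {Ω' : Type*} (hf : Bdd f) (u : Ω' → Ω) : Bdd (fun ω => f (u ω)) := by
  obtain ⟨C, hC⟩ := hf
  exact ⟨C, fun ω => hC _⟩

lemma sum {ι : Type*} (s : Finset ι) {F : ι → Ω → ℝ} (hF : ∀ i ∈ s, Bdd (F i)) :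
    Bdd (fun ω => ∑ i ∈ s, F i ω) := by
  classical
  induction s using Finset.induction_on with
  | empty => simpa using const 0
  | insert a s ha ih =>
    simp only [Finset.sum_insert ha]
    exact (hF a (by simp)).add (ih fun i hi => hF i (by simp [hi]))

lemma prod_mem_Icc {ι : Type*} (s : Finset ι) {F : ι → Ω → ℝ}
    (hF : ∀ i ω, F i ω ∈ Set.Icc (0 : ℝ) 1) (ω : Ω) : ∏ i ∈ s, F i ω ∈ Set.Icc (0 : ℝ) 1 :=
  ⟨Finset.prod_nonneg fun i _ => (hF i ω).1,
    Finset.prod_le_one (fun i _ => (hF i ω).1) fun i _ => (hF i ω).2⟩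

end Bdd

/-- A mean on `Ω`: a positive normalised linear functional on the bounded real functions, that is,
the integral against a finitely additive probability measure on all subsets of `Ω`. It is a total
function; its values at unbounded functions are irrelevant. -/
structure Mean (Ω : Type*) where
  /-- The underlying functional. -/
  toFun : (Ω → ℝ) → ℝ
  map_add' : ∀ f g, Bdd f → Bdd g → toFun (fun ω => f ω + g ω) = toFun f + toFun g
  map_const_mul' : ∀ (c : ℝ) f, Bdd f → toFun (fun ω => c * f ω) = c * toFun f
  map_nonneg' : ∀ f, Bdd f → (∀ ω, 0 ≤ f ω) → 0 ≤ toFun f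
  map_one' : toFun (fun _ => 1) = 1

namespace Mean

instance {Ω : Type*} : CoeFun (Mean Ω) (fun _ => (Ω → ℝ) → ℝ) := ⟨toFun⟩

variable {Ω : Type*} (M : Mean Ω) {f g : Ω → ℝ}

lemma add (hf : Bdd f) (hg : Bdd g) : M (fun ω => f ω + g ω) = M f + M g := M.map_add' f g hf hg

lemma const_mul (c : ℝ) (hf : Bdd f) : M (fun ω => c * f ω) = c * M f := M.map_const_mul' c f hf

lemma nonneg (hf : Bdd f) (h : ∀ ω, 0 ≤ f ω) : 0 ≤ M f := M.map_nonneg' f hf h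

lemma const (c : ℝ) : M (fun _ => c) = c := by
  have := M.const_mul c (Bdd.const 1)
  simpa [M.map_one'] using this

lemma sub (hf : Bdd f) (hg : Bdd g) : M (fun ω => f ω - g ω) = M f - M g := by
  have := M.add hf (hg.const_mul (-1))
  rw [M.const_mul (-1) hg] at this
  simpa [sub_eq_add_neg] using this

lemma mono (hf : Bdd f) (hg : Bdd g) (h : ∀ ω, f ω ≤ g ω) : M f ≤ M g := by
  have := M.nonneg (hg.sub hf) fun ω => sub_nonneg.2 (h ω)
  rw [M.sub hg hf] at this
  linarith

lemma sum {ι : Type*} (s : Finset ι) {F : ι → Ω → ℝ} (hF : ∀ i ∈ s, Bdd (F i)) :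
    M (fun ω => ∑ i ∈ s, F i ω) = ∑ i ∈ s, M (F i) := by
  classical
  induction s using Finset.induction_on with
  | empty => simpa using M.const 0
  | insert a s ha ih =>
    simp only [Finset.sum_insert ha]
    rw [M.add (hF a (by simp)) (Bdd.sum s fun i hi => hF i (by simp [hi])),
      ih fun i hi => hF i (by simp [hi])]

end Mean

/-! ### Laws and Shannon entropy with respect to a mean -/

section Entropy

variable {Ω : Type*} (M : Mean Ω) {α β γ : Type*}

open Classical in
/-- The law of a variable `f` under a mean: `law M f a` is the measure of `{f = a}`. -/
noncomputable def law (f : Ω → α) (a : α) : ℝ := M fun ω => if f ω = a then 1 else 0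

lemma law_nonneg (f : Ω → α) (a : α) : 0 ≤ law M f a := by
  classical
  exact M.nonneg (Bdd.ite _) fun ω => by split_ifs <;> simp

lemma law_eq_zero (f : Ω → α) {a : α} (h : ∀ ω, f ω ≠ a) : law M f a = 0 := by
  simp only [law, if_neg (h _)]
  exact M.const 0

/-- Change of variables for a variable with finitely many values. -/
lemma mean_comp [Fintype α] (f : Ω → α) (G : α → ℝ) :
    M (fun ω => G (f ω)) = ∑ a, law M f a * G a := by
  classical
  have h : (fun ω => G (f ω)) = fun ω => ∑ a, G a * (if f ω = a then (1 : ℝ) else 0) := by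
    funext ω; simp
  rw [h, M.sum _ fun a _ => (Bdd.ite _).const_mul _]
  refine Finset.sum_congr rfl fun a _ => ?_
  rw [M.const_mul _ (Bdd.ite _), mul_comm]
  rfl

lemma sum_law [Fintype α] (f : Ω → α) : ∑ a, law M f a = 1 := by
  have := mean_comp M f fun _ => 1
  simpa [M.const] using this.symm

/-- Marginals of a law. -/
lemma sum_law_mul_comp [Fintype α] [Fintype β] (f : Ω → α) (g : α → β) (G : β → ℝ) :
    ∑ a, law M f a * G (g a) = ∑ b, law M (fun ω => g (f ω)) b * G b := by
  rw [← mean_comp M f fun a => G (g a), ← mean_comp M (fun ω => g (f ω)) G]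

lemma sum_law_prodMk [Fintype α] [Fintype β] (f : Ω → α) (g : Ω → β) (b : β) :
    ∑ a, law M (fun ω => (f ω, g ω)) (a, b) = law M g b := by
  classical
  have h := sum_law_mul_comp M (fun ω => (f ω, g ω)) Prod.snd fun b' =>
    if b' = b then (1 : ℝ) else 0
  rw [Fintype.sum_prod_type] at h
  simpa using h

lemma law_le_law_comp (f : Ω → α) (g : α → β) (a : α) :
    law M f a ≤ law M (fun ω => g (f ω)) (g a) := by
  classical
  refine M.mono (Bdd.ite _) (Bdd.ite _) fun ω => ?_
  by_cases h : f ω = a <;> simp [h]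
  split_ifs <;> simp

/-- The Shannon entropy of a variable with finitely many values. -/
noncomputable def ent [Fintype α] (f : Ω → α) : ℝ := -∑ a, law M f a * Real.log (law M f a)

/-- The entropy of a function of `f`, as a sum over the values of `f`. -/
lemma sum_law_mul_log_comp [Fintype α] [Fintype β] (f : Ω → α) (g : α → β) :
    ∑ a, law M f a * Real.log (law M (fun ω => g (f ω)) (g a)) = -ent M (fun ω => g (f ω)) := by
  rw [sum_law_mul_comp M f g fun b => Real.log (law M (fun ω => g (f ω)) b), ent, neg_neg]

/-- Variables that determine each other have the same entropy: on the values that are attained, the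
law of the pair coincides with the law of either variable. -/
lemma ent_congr [Fintype α] [Fintype β] (f : Ω → α) (g : Ω → β)
    (h : ∀ ω ω', f ω = f ω' ↔ g ω = g ω') : ent M f = ent M g := by
  classical
  have hf := sum_law_mul_log_comp M (fun ω => (f ω, g ω)) Prod.fst
  have hg := sum_law_mul_log_comp M (fun ω => (f ω, g ω)) Prod.snd
  suffices hfg : ∀ ab : α × β, law M (fun ω => (f ω, g ω)) ab * Real.log (law M f ab.1) =
      law M (fun ω => (f ω, g ω)) ab * Real.log (law M g ab.2) by
    have := Finset.sum_congr (rfl : (Finset.univ : Finset (α × β)) = _) fun ab _ => hfg ab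
    linarith
  rintro ⟨a, b⟩
  by_cases hab : ∃ ω, f ω = a ∧ g ω = b
  · obtain ⟨ω, rfl, rfl⟩ := hab
    simp only [law, h]
  · have : law M (fun ω => (f ω, g ω)) (a, b) = 0 :=
      law_eq_zero M _ fun ω h1 => hab ⟨ω, by simpa using h1⟩
    simp [this]

/-- Gibbs' inequality. -/
lemma sum_mul_log_le [Fintype α] (p r : α → ℝ) (hp : ∀ a, 0 ≤ p a) (hr : ∀ a, 0 ≤ r a)
    (hpr : ∀ a, 0 < p a → 0 < r a) (hsum : ∑ a, r a ≤ ∑ a, p a) :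
    ∑ a, p a * Real.log (r a) ≤ ∑ a, p a * Real.log (p a) := by
  have key : ∀ a, p a * Real.log (r a) ≤ p a * Real.log (p a) + (r a - p a) := by
    intro a
    rcases (hp a).eq_or_lt with h0 | h0
    · simpa [← h0] using hr a
    · have h1 := Real.log_le_sub_one_of_pos (div_pos (hpr a h0) h0)
      rw [Real.log_div (hpr a h0).ne' h0.ne'] at h1
      have h2 := mul_le_mul_of_nonneg_left h1 h0.le
      have h3 : p a * (r a / p a - 1) = r a - p a := by field_simp
      linarith
  calc ∑ a, p a * Real.log (r a) ≤ ∑ a, (p a * Real.log (p a) + (r a - p a)) :=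
        Finset.sum_le_sum fun a _ => key a
    _ = ∑ a, p a * Real.log (p a) + (∑ a, r a - ∑ a, p a) := by
        rw [Finset.sum_add_distrib, Finset.sum_sub_distrib]
    _ ≤ _ := by linarith

/-- Entropy of a function of a variable is at most the entropy of the variable. -/
lemma ent_comp_le [Fintype α] [Fintype β] (f : Ω → α) (g : α → β) :
    ent M (fun ω => g (f ω)) ≤ ent M f := by
  have h := sum_law_mul_log_comp M f g
  have : ∑ a, law M f a * Real.log (law M f a) ≤
      ∑ a, law M f a * Real.log (law M (fun ω => g (f ω)) (g a)) := by
    refine Finset.sum_le_sum fun a _ => ?_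
    rcases (law_nonneg M f a).eq_or_lt with h0 | h0
    · simp [← h0]
    · exact mul_le_mul_of_nonneg_left (Real.log_le_log h0 (law_le_law_comp M f g a)) h0.le
  have e : ent M f = -∑ a, law M f a * Real.log (law M f a) := rfl
  linarith

/-- Submodularity of entropy: conditionally on `z`, the entropy of a pair is at most the sum of the
entropies. -/
lemma ent_submodular [Fintype α] [Fintype β] [Fintype γ] (x : Ω → α) (y : Ω → β) (z : Ω → γ) :
    ent M (fun ω => (x ω, y ω, z ω)) + ent M z ≤
      ent M (fun ω => (x ω, z ω)) + ent M (fun ω => (y ω, z ω)) := by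
  classical
  set f : Ω → α × β × γ := fun ω => (x ω, y ω, z ω) with hf
  set pxz := law M (fun ω => (x ω, z ω)) with hpxz
  set pyz := law M (fun ω => (y ω, z ω)) with hpyz
  set pz := law M z with hpz
  have hxz := sum_law_mul_log_comp M f fun a => (a.1, a.2.2)
  have hyz := sum_law_mul_log_comp M f fun a => a.2
  have hz := sum_law_mul_log_comp M f fun a => a.2.2
  have le_xz : ∀ a, law M f a ≤ pxz (a.1, a.2.2) := law_le_law_comp M f fun a => (a.1, a.2.2)
  have le_yz : ∀ a, law M f a ≤ pyz a.2 := law_le_law_comp M f fun a => a.2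
  have le_z : ∀ a, law M f a ≤ pz a.2.2 := law_le_law_comp M f fun a => a.2.2
  -- Gibbs' inequality is applied to the coupling that makes `x` and `y` independent given `z`.
  have hsum : ∑ a : α × β × γ, pxz (a.1, a.2.2) * pyz a.2 / pz a.2.2 ≤ ∑ a, law M f a := by
    rw [sum_law, Fintype.sum_prod_type]
    simp only [Fintype.sum_prod_type]
    calc ∑ a, ∑ b, ∑ c, pxz (a, c) * pyz (b, c) / pz c
        = ∑ c, (∑ a, pxz (a, c)) * (∑ b, pyz (b, c)) / pz c := by
          simp_rw [Finset.sum_mul_sum, Finset.sum_div]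
          rw [Finset.sum_congr rfl fun a _ => Finset.sum_comm, Finset.sum_comm]
      _ ≤ ∑ c, pz c := by
          refine Finset.sum_le_sum fun c _ => ?_
          rw [sum_law_prodMk M x z, sum_law_prodMk M y z]
          rcases eq_or_ne (pz c) 0 with h0 | h0
          · simp [h0]
          · rw [mul_div_assoc, div_self h0, mul_one]
      _ = 1 := sum_law M z
  have hG := sum_mul_log_le (law M f) (fun a => pxz (a.1, a.2.2) * pyz a.2 / pz a.2.2)
    (law_nonneg M f)
    (fun a => div_nonneg (mul_nonneg (law_nonneg M _ _) (law_nonneg M _ _)) (law_nonneg M _ _))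
    (fun a ha => div_pos (mul_pos (ha.trans_le (le_xz a)) (ha.trans_le (le_yz a)))
      (ha.trans_le (le_z a))) hsum
  have hlog : ∀ a, law M f a * Real.log (pxz (a.1, a.2.2) * pyz a.2 / pz a.2.2) =
      law M f a * Real.log (pxz (a.1, a.2.2)) + law M f a * Real.log (pyz a.2) -
        law M f a * Real.log (pz a.2.2) := by
    intro a
    rcases (law_nonneg M f a).eq_or_lt with h0 | h0
    · simp [← h0]
    · have h1 := h0.trans_le (le_xz a)
      have h2 := h0.trans_le (le_yz a)
      have h3 := h0.trans_le (le_z a)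
      rw [Real.log_div (mul_pos h1 h2).ne' h3.ne', Real.log_mul h1.ne' h2.ne']
      ring
  simp only [hlog, Finset.sum_add_distrib, Finset.sum_sub_distrib] at hG
  have e : ent M f = -∑ a, law M f a * Real.log (law M f a) := rfl
  simp only [hf] at *
  linarith

/-- The Gibbs variational principle in the form used for the entropy decrement. If `W (f, y)` has
mean zero under the uniform distribution of `y` for each fixed value of `f`, then its mean is
controlled by the deficit of `y` from being uniform and independent of `f`. -/
lemma mul_mean_le_ent [Fintype α] [Fintype β] [Nonempty β] (f : Ω → α) (y : Ω → β)
    (W : α → β → ℝ) {C t : ℝ} (hW : ∀ a, ∑ b, W a b = 0) (hC : ∀ a b, |W a b| ≤ C)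
    (ht : 0 ≤ t) (htC : t * C ≤ 1) :
    t * M (fun ω => W (f ω) (y ω)) ≤
      ent M f + Real.log (Fintype.card β) - ent M (fun ω => (f ω, y ω)) + (t * C) ^ 2 := by
  classical
  set p := law M fun ω => (f ω, y ω) with hp
  have hcard : (0 : ℝ) < Fintype.card β := by exact_mod_cast Fintype.card_pos
  have hf := sum_law_mul_log_comp M (fun ω => (f ω, y ω)) Prod.fst
  have hmean := mean_comp M (fun ω => (f ω, y ω)) fun a => W a.1 a.2
  have hone := sum_law M (fun ω => (f ω, y ω))
  -- The product of the law of `f` with the uniform law, tilted by `exp (t W)`; the factor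
  -- `exp (-(t C) ^ 2)` makes its total mass at most one.
  set r : α × β → ℝ := fun a =>
    law M f a.1 / Fintype.card β * Real.exp (t * W a.1 a.2 - (t * C) ^ 2) with hr
  have hexp : ∀ a, ∑ b, Real.exp (t * W a b - (t * C) ^ 2) ≤ Fintype.card β := by
    intro a
    have h1 : ∀ b, Real.exp (t * W a b) ≤ 1 + t * W a b + (t * C) ^ 2 := by
      intro b
      have h2 : |t * W a b| ≤ t * C := by
        rw [abs_mul, abs_of_nonneg ht]
        exact mul_le_mul_of_nonneg_left (hC a b) ht
      have h3 := (abs_le.1 (Real.abs_exp_sub_one_sub_id_le (h2.trans htC))).2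
      have h4 : (t * W a b) ^ 2 ≤ (t * C) ^ 2 := sq_le_sq' (by linarith [(abs_le.1 h2).1])
        (abs_le.1 h2).2
      linarith
    calc ∑ b, Real.exp (t * W a b - (t * C) ^ 2)
        = (∑ b, Real.exp (t * W a b)) * Real.exp (-(t * C) ^ 2) := by
          rw [Finset.sum_mul]
          exact Finset.sum_congr rfl fun b _ => by rw [← Real.exp_add]; ring_nf
      _ ≤ (∑ b, (1 + t * W a b + (t * C) ^ 2)) * Real.exp (-(t * C) ^ 2) :=
          mul_le_mul_of_nonneg_right (Finset.sum_le_sum fun b _ => h1 b) (Real.exp_pos _).le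
      _ = Fintype.card β * ((1 + (t * C) ^ 2) * Real.exp (-(t * C) ^ 2)) := by
          rw [Finset.sum_add_distrib, Finset.sum_add_distrib, ← Finset.mul_sum, hW a]
          simp only [Finset.sum_const, Finset.card_univ, nsmul_eq_mul]
          ring
      _ ≤ Fintype.card β * 1 := by
          refine mul_le_mul_of_nonneg_left ?_ hcard.le
          have h5 := Real.add_one_le_exp ((t * C) ^ 2)
          calc (1 + (t * C) ^ 2) * Real.exp (-(t * C) ^ 2)
              ≤ Real.exp ((t * C) ^ 2) * Real.exp (-(t * C) ^ 2) :=
                mul_le_mul_of_nonneg_right (by linarith) (Real.exp_pos _).le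
            _ = 1 := by rw [← Real.exp_add]; simp
      _ = Fintype.card β := mul_one _
  have hsum : ∑ a, r a ≤ ∑ a, p a := by
    rw [hone, Fintype.sum_prod_type]
    calc ∑ a, ∑ b, r (a, b)
        = ∑ a, law M f a / Fintype.card β * ∑ b, Real.exp (t * W a b - (t * C) ^ 2) := by
          simp only [hr, Finset.mul_sum]
      _ ≤ ∑ a, law M f a / Fintype.card β * Fintype.card β :=
          Finset.sum_le_sum fun a _ => mul_le_mul_of_nonneg_left (hexp a)
            (div_nonneg (law_nonneg M f a) hcard.le)
      _ = 1 := by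
          rw [← sum_law M f]
          exact Finset.sum_congr rfl fun a _ => div_mul_cancel₀ _ hcard.ne'
  have hle : ∀ a, p a ≤ law M f a.1 := law_le_law_comp M (fun ω => (f ω, y ω)) Prod.fst
  have hG := sum_mul_log_le p r (law_nonneg M _)
    (fun a => mul_nonneg (div_nonneg (law_nonneg M f _) hcard.le) (Real.exp_pos _).le)
    (fun a ha => mul_pos (div_pos (ha.trans_le (hle a)) hcard) (Real.exp_pos _)) hsum
  have hlog : ∀ a, p a * Real.log (r a) = p a * Real.log (law M f a.1) -
      Real.log (Fintype.card β) * p a + t * (p a * W a.1 a.2) - (t * C) ^ 2 * p a := by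
    intro a
    rcases (law_nonneg M (fun ω => (f ω, y ω)) a).eq_or_lt with h0 | h0
    · simp [hp, ← h0]
    · have h1 := h0.trans_le (hle a)
      rw [hr, Real.log_mul (div_pos h1 hcard).ne' (Real.exp_pos _).ne',
        Real.log_div h1.ne' hcard.ne', Real.log_exp]
      ring
  simp only [hlog, Finset.sum_add_distrib, Finset.sum_sub_distrib, ← Finset.mul_sum] at hG
  have e : ent M (fun ω => (f ω, y ω)) = -∑ a, p a * Real.log (p a) := rfl
  simp only [hp] at *
  rw [hone] at hG
  rw [hmean]
  linarith

end Entropy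

/-! ### The entropy decrement argument -/

section Decrement

variable {Z : Type*} {α : Type*}

/-- Translation by `h` in the second coordinate of `Z × ℤ`. -/
def tr (h : ℤ) (ω : Z × ℤ) : Z × ℤ := (ω.1, ω.2 + h)

@[simp] lemma tr_fst (h : ℤ) (ω : Z × ℤ) : (tr h ω).1 = ω.1 := rfl

@[simp] lemma tr_snd (h : ℤ) (ω : Z × ℤ) : (tr h ω).2 = ω.2 + h := rfl

lemma tr_tr (h h' : ℤ) (ω : Z × ℤ) : tr h (tr h' ω) = tr (h' + h) ω := by
  simp [tr, add_assoc]

/-- A mean on `Z × ℤ` is invariant if translation by one in the second coordinate preserves it. -/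
def Mean.Invariant (M : Mean (Z × ℤ)) : Prop :=
  ∀ f : Z × ℤ → ℝ, Bdd f → M (fun ω => f (tr 1 ω)) = M f

variable {M : Mean (Z × ℤ)}

lemma Mean.Invariant.map_tr (hM : M.Invariant) (h : ℤ) {f : Z × ℤ → ℝ} (hf : Bdd f) :
    M (fun ω => f (tr h ω)) = M f := by
  induction h with
  | zero => simp [tr]
  | succ i ih =>
    rw [← ih, ← hM _ (hf.comp (tr (i : ℤ)))]
    simp only [tr_tr, add_comm]
  | pred i ih =>
    rw [← ih, ← hM _ (hf.comp (tr (-i - 1 : ℤ)))]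
    simp only [tr_tr, add_sub_cancel]

lemma law_comp_tr (hM : M.Invariant) {β : Type*} (h : ℤ) (f : Z × ℤ → β) (b : β) :
    law M (fun ω => f (tr h ω)) b = law M f b := by
  classical
  exact hM.map_tr h (Bdd.ite fun ω => f ω = b)

lemma ent_comp_tr (hM : M.Invariant) {β : Type*} [Fintype β] (h : ℤ) (f : Z × ℤ → β) :
    ent M (fun ω => f (tr h ω)) = ent M f := by
  simp only [ent, law_comp_tr hM]

/-- Residues are uniformly distributed under an invariant mean. -/
lemma law_residue (hM : M.Invariant) (N : ℕ) [NeZero N] (a : ZMod N) :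
    law M (fun ω => (ω.2 : ZMod N)) a = 1 / N := by
  have step : ∀ a : ZMod N, law M (fun ω => (ω.2 : ZMod N)) (a + 1) =
      law M (fun ω => (ω.2 : ZMod N)) a := by
    intro a
    rw [← law_comp_tr hM 1]
    simp only [law, tr_snd, Int.cast_add, Int.cast_one, add_left_inj]
    congr!
  have all : ∀ a : ZMod N, law M (fun ω => (ω.2 : ZMod N)) a =
      law M (fun ω => (ω.2 : ZMod N)) 0 := by
    intro a
    rw [← ZMod.natCast_zmod_val a]
    induction a.val with
    | zero => simp
    | succ i ih => rw [Nat.cast_add, Nat.cast_one, step, ih]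
  have hs := sum_law M fun ω => (ω.2 : ZMod N)
  rw [Finset.sum_congr rfl fun a _ => all a] at hs
  simp only [Finset.sum_const, Finset.card_univ, ZMod.card, nsmul_eq_mul] at hs
  have hN : (N : ℝ) ≠ 0 := Nat.cast_ne_zero.2 (NeZero.ne N)
  rw [all a]
  field_simp
  linarith

lemma ent_residue (hM : M.Invariant) (N : ℕ) [NeZero N] :
    ent M (fun ω => (ω.2 : ZMod N)) = Real.log N := by
  have hN : (N : ℝ) ≠ 0 := Nat.cast_ne_zero.2 (NeZero.ne N)
  simp only [ent, law_residue hM, Finset.sum_const, Finset.card_univ, ZMod.card, nsmul_eq_mul]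
  rw [one_div, Real.log_inv]
  field_simp

/-- The word of length `ℓ` read off from position `ω` along the orbit under translation. -/
def block (b : Z × ℤ → α) (ℓ : ℕ) (ω : Z × ℤ) : Fin ℓ → α := fun i => b (tr (i : ℕ) ω)

instance (n : ℕ) : NeZero (primorial n) := ⟨(primorial_pos n).ne'⟩

variable [Fintype α] (b : Z × ℤ → α)

variable (M) in
/-- The entropy of a word of length `ℓ` conditioned on the residues of the position modulo all
primes up to `n`. -/
noncomputable def condEnt (ℓ n : ℕ) : ℝ :=
  ent M (fun ω => (block b ℓ ω, (ω.2 : ZMod (primorial n)))) - Real.log (primorial n)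

lemma condEnt_nonneg (hM : M.Invariant) (ℓ n : ℕ) : 0 ≤ condEnt M b ℓ n := by
  have := ent_comp_le M (fun ω => (block b ℓ ω, (ω.2 : ZMod (primorial n)))) Prod.snd
  rw [ent_residue hM] at this
  exact sub_nonneg.2 this

/-- Subadditivity: a word of length `2 ℓ` consists of a word of length `ℓ` and of its translate by
`ℓ`, and translation permutes the residues. -/
lemma condEnt_two_mul_le (hM : M.Invariant) (ℓ n : ℕ) :
    condEnt M b (ℓ * 2) n ≤ 2 * condEnt M b ℓ n := by
  set N := primorial n
  have h1 := ent_submodular M (block b ℓ) (fun ω => block b ℓ (tr ℓ ω)) fun ω => (ω.2 : ZMod N)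
  have h2 : ent M (fun ω => (block b ℓ (tr ℓ ω), (ω.2 : ZMod N))) =
      ent M (fun ω => (block b ℓ ω, (ω.2 : ZMod N))) := by
    rw [← ent_comp_tr hM ℓ fun ω => (block b ℓ ω, (ω.2 : ZMod N))]
    exact ent_congr M _ _ fun ω ω' => by simp
  have h3 : ent M (fun ω => (block b ℓ ω, block b ℓ (tr ℓ ω), (ω.2 : ZMod N))) =
      ent M (fun ω => (block b (ℓ * 2) ω, (ω.2 : ZMod N))) := by
    refine ent_congr M _ _ fun ω ω' => ?_
    simp only [Prod.mk.injEq, ← and_assoc]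
    refine and_congr_left fun _ => ?_
    simp only [funext_iff, block, tr_tr]
    constructor
    · rintro ⟨hl, hr⟩ ⟨i, hi⟩
      rcases lt_or_ge i ℓ with h | h
      · exact hl ⟨i, h⟩
      · have := hr ⟨i - ℓ, by omega⟩
        simpa [Nat.cast_sub h] using this
    · intro h
      refine ⟨fun i => h ⟨i, by omega⟩, fun i => ?_⟩
      simpa using h ⟨ℓ + i, by omega⟩
  rw [h2, h3, ent_residue hM] at h1
  simp only [condEnt]
  linarith

/-- The basic inequality of the entropy decrement: a function of the word and of the residue modulo
the prime `n + 1` which has mean zero over the residues can have a substantial mean only at the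
cost of a drop of the conditional entropy. -/
lemma mul_mean_le_condEnt_sub {ℓ n : ℕ} (hp : (n + 1).Prime) (W : (Fin ℓ → α) → ZMod (n + 1) → ℝ)
    {C t : ℝ} (hW : ∀ a, ∑ y, W a y = 0) (hC : ∀ a y, |W a y| ≤ C) (ht : 0 ≤ t)
    (htC : t * C ≤ 1) :
    t * M (fun ω => W (block b ℓ ω) ω.2) ≤
      condEnt M b ℓ n - condEnt M b ℓ (n + 1) + (t * C) ^ 2 := by
  have h1 := mul_mean_le_ent M (fun ω => (block b ℓ ω, (ω.2 : ZMod (primorial n))))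
    (fun ω => (ω.2 : ZMod (n + 1))) (fun a y => W a.1 y) (fun a => hW a.1) (fun a => hC a.1) ht htC
  have hprim : primorial (n + 1) = (n + 1) * primorial n := by
    rw [primorial, Finset.range_add_one, Finset.filter_insert, if_pos hp,
      Finset.prod_insert (by simp)]
    rfl
  have hcop : Nat.Coprime (n + 1) (primorial n) := by
    rw [primorial, Nat.coprime_prod_right_iff]
    intro q hq
    simp only [Finset.mem_filter, Finset.mem_range] at hq
    exact (Nat.coprime_primes hp hq.2).2 (by omega)
  have h2 : ent M (fun ω => ((block b ℓ ω, (ω.2 : ZMod (primorial n))), (ω.2 : ZMod (n + 1)))) =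
      ent M (fun ω => (block b ℓ ω, (ω.2 : ZMod (primorial (n + 1))))) := by
    refine ent_congr M _ _ fun ω ω' => ?_
    simp only [Prod.mk.injEq, and_assoc]
    refine and_congr_right fun _ => ?_
    rw [ZMod.intCast_eq_intCast_iff_dvd_sub, ZMod.intCast_eq_intCast_iff_dvd_sub,
      ZMod.intCast_eq_intCast_iff_dvd_sub, hprim]
    push_cast
    constructor
    · rintro ⟨h, h'⟩
      exact IsCoprime.mul_dvd (by exact_mod_cast Nat.isCoprime_iff_coprime.2 hcop)
        (by exact_mod_cast h') h
    · intro h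
      exact ⟨(dvd_mul_left _ _).trans h, (dvd_mul_right _ _).trans h⟩
  have h3 : Real.log (primorial (n + 1)) = Real.log ((n + 1 : ℕ) : ℝ) + Real.log (primorial n) := by
    rw [hprim, Nat.cast_mul, Real.log_mul (by positivity)
      (Nat.cast_ne_zero.2 (primorial_pos n).ne')]
  rw [h2, ZMod.card] at h1
  simp only [condEnt, h3]
  linarith

lemma condEnt_succ_le (ℓ n : ℕ) : condEnt M b ℓ (n + 1) ≤ condEnt M b ℓ n := by
  by_cases hp : (n + 1).Prime
  · have := mul_mean_le_condEnt_sub (M := M) b hp (fun _ _ => 0 : (Fin ℓ → α) → ZMod (n + 1) → ℝ)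
      (C := 0) (t := 0) (by simp) (by simp) le_rfl (by simp)
    simpa using this
  · have : primorial (n + 1) = primorial n := by
      rw [primorial, Finset.range_add_one, Finset.filter_insert, if_neg hp]
      rfl
    have h2 : ent M (fun ω => (block b ℓ ω, (ω.2 : ZMod (primorial (n + 1))))) =
        ent M (fun ω => (block b ℓ ω, (ω.2 : ZMod (primorial n)))) := by
      refine ent_congr M _ _ fun ω ω' => ?_
      simp only [Prod.mk.injEq, ZMod.intCast_eq_intCast_iff_dvd_sub, this]
    rw [condEnt, condEnt, h2, this]

/-- With word lengths proportional to the dyadic scale of `n`, the entropy drops are summable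
against `1 / n`. -/
lemma sum_condEnt_drop_le (hM : M.Invariant) (K P : ℕ) :
    ∑ n ∈ Finset.range P, (condEnt M b (K * 2 ^ Nat.log 2 (n + 1)) n -
      condEnt M b (K * 2 ^ Nat.log 2 (n + 1)) (n + 1)) / (n + 1 : ℕ) ≤ condEnt M b K 0 := by
  -- The normalised conditional entropy per dyadic scale, which decreases in `n`.
  set a : ℕ → ℝ := fun n => condEnt M b (K * 2 ^ Nat.log 2 (n + 1)) n / 2 ^ Nat.log 2 (n + 1)
    with ha
  have step : ∀ n, (condEnt M b (K * 2 ^ Nat.log 2 (n + 1)) n -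
      condEnt M b (K * 2 ^ Nat.log 2 (n + 1)) (n + 1)) / (n + 1 : ℕ) ≤ a n - a (n + 1) := by
    intro n
    set L := Nat.log 2 (n + 1)
    have hpow : (2 : ℝ) ^ L ≤ (n + 1 : ℕ) := by
      exact_mod_cast Nat.pow_log_le_self 2 (Nat.succ_ne_zero n)
    have h1 : a (n + 1) ≤ condEnt M b (K * 2 ^ L) (n + 1) / 2 ^ L := by
      have hL : Nat.log 2 (n + 1 + 1) = L ∨ Nat.log 2 (n + 1 + 1) = L + 1 := by
        have h1 : L ≤ Nat.log 2 (n + 1 + 1) := Nat.log_mono_right (Nat.le_succ _)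
        have h2 : Nat.log 2 (n + 1 + 1) < L + 2 := by
          apply Nat.log_lt_of_lt_pow (by omega)
          have := Nat.lt_pow_succ_log_self (b := 2) (by norm_num) (n + 1)
          have h3 : 2 ^ (L + 2) = 2 * 2 ^ (L + 1) := by ring
          change n + 1 < 2 ^ (L + 1) at this
          omega
        omega
      rcases hL with hL | hL
      · simp only [ha, hL]; exact le_rfl
      · simp only [ha, hL]
        rw [div_le_div_iff₀ (by positivity) (by positivity), pow_succ, pow_succ, ← mul_assoc]
        have := condEnt_two_mul_le b hM (K * 2 ^ L) (n + 1)
        have h2 : (0 : ℝ) < 2 ^ L := by positivity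
        nlinarith
    have h2 : (condEnt M b (K * 2 ^ L) n - condEnt M b (K * 2 ^ L) (n + 1)) / (n + 1 : ℕ) ≤
        (condEnt M b (K * 2 ^ L) n - condEnt M b (K * 2 ^ L) (n + 1)) / 2 ^ L :=
      div_le_div_of_nonneg_left (sub_nonneg.2 (condEnt_succ_le b _ n)) (by positivity) hpow
    have h3 : a n = condEnt M b (K * 2 ^ L) n / 2 ^ L := rfl
    have h4 := sub_div (condEnt M b (K * 2 ^ L) n) (condEnt M b (K * 2 ^ L) (n + 1)) (2 ^ L)
    linarith
  calc _ ≤ ∑ n ∈ Finset.range P, (a n - a (n + 1)) := Finset.sum_le_sum fun n _ => step n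
    _ = a 0 - a P := Finset.sum_range_sub' a P
    _ ≤ a 0 := sub_le_self _ (div_nonneg (condEnt_nonneg b hM _ _) (by positivity))
    _ = condEnt M b K 0 := by simp [ha]

end Decrement

section Pattern

variable {Z : Type*} {α ι : Type*}

/-- The value of a statistic `ϕ` at the pattern of letters `b` read off at the positions
`ω + p * h i`. -/
def pattern (b : Z × ℤ → α) (h : ι → ℤ) (ϕ : (ι → α) → ℝ) (p : ℤ) (ω : Z × ℤ) : ℝ :=
  ϕ fun i => b (tr (p * h i) ω)

variable {M : Mean (Z × ℤ)} (b : Z × ℤ → α) {h : ι → ℤ} {ϕ : (ι → α) → ℝ}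

lemma pattern_mem_Icc (hϕ : ∀ v, ϕ v ∈ Set.Icc (0 : ℝ) 1) (p : ℤ) (ω : Z × ℤ) :
    pattern b h ϕ p ω ∈ Set.Icc (0 : ℝ) 1 := hϕ _

lemma pattern_tr (p j : ℤ) (ω : Z × ℤ) :
    pattern b h ϕ p (tr j ω) = ϕ fun i => b (tr (j + p * h i) ω) := by
  simp only [pattern, tr_tr]

/-- Averaging the pattern statistic over a dyadic window of translates compares its mean with its
mean over the multiples of the prime `p = n + 1`, at the cost of an entropy drop. -/
lemma mul_mean_pattern_sub_le [Fintype α] (hM : M.Invariant)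
    (hϕ : ∀ v, ϕ v ∈ Set.Icc (0 : ℝ) 1) {R : ℕ}
    (hR : ∀ i, |h i| ≤ R) {n : ℕ} (hp : (n + 1).Prime) {t : ℝ} (ht : 0 ≤ t) (ht3 : t * 3 ≤ 1) :
    t * (M (pattern b h ϕ (n + 1 : ℕ)) - (n + 1 : ℕ) *
        M (fun ω => if ((n + 1 : ℕ) : ℤ) ∣ ω.2 then pattern b h ϕ (n + 1 : ℕ) ω else 0)) ≤
      condEnt M b ((4 * R + 1) * 2 ^ Nat.log 2 (n + 1)) n -
        condEnt M b ((4 * R + 1) * 2 ^ Nat.log 2 (n + 1)) (n + 1) + (t * 3) ^ 2 := by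
  classical
  set p := n + 1 with hpdef
  set L := 2 ^ Nat.log 2 p with hL
  have hLp : L ≤ p := Nat.pow_log_le_self 2 (Nat.succ_ne_zero n)
  have hpL : p < L * 2 := by
    have := Nat.lt_pow_succ_log_self (b := 2) (by norm_num) p
    rwa [pow_succ] at this
  have hL0 : 0 < L := by positivity
  have hLR : (0 : ℝ) < L := by exact_mod_cast hL0
  -- Position inside a word of length `(4R + 1) L` of the shift by `j + p * h i`, `j < L`,
  -- after recentring by `2RL`.
  have hpos : ∀ (j : ℕ), j < L → ∀ i, 0 ≤ ((2 * R * L + j : ℕ) : ℤ) + p * h i ∧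
      (((2 * R * L + j : ℕ) : ℤ) + p * h i).toNat < (4 * R + 1) * L := by
    intro j hj i
    have h1 := abs_le.1 (hR i)
    have h2 : (p : ℤ) * h i ≤ p * R := mul_le_mul_of_nonneg_left h1.2 (by positivity)
    have h3 : (p : ℤ) * (-R) ≤ p * h i := mul_le_mul_of_nonneg_left h1.1 (by positivity)
    have h4 : (p : ℤ) * R ≤ (L * 2) * R :=
      mul_le_mul_of_nonneg_right (by exact_mod_cast hpL.le) (by positivity)
    have h5 : 0 ≤ ((2 * R * L + j : ℕ) : ℤ) + p * h i := by push_cast; nlinarith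
    refine ⟨h5, ?_⟩
    rw [← Nat.cast_lt (α := ℤ), Int.toNat_of_nonneg h5]
    push_cast
    have : (j : ℤ) < L := by exact_mod_cast hj
    nlinarith
  set F : ℕ → (Fin ((4 * R + 1) * L) → α) → ℝ := fun j x =>
    if hj : j < L then
      ϕ fun i => x ⟨(((2 * R * L + j : ℕ) : ℤ) + p * h i).toNat, (hpos j hj i).2⟩
    else 0 with hF
  have hF01 : ∀ j x, F j x ∈ Set.Icc (0 : ℝ) 1 := by
    intro j x
    simp only [hF]
    split_ifs
    · exact hϕ _
    · simp
  have hFblock : ∀ j, j < L → ∀ ω, F j (block b _ ω) =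
      pattern b h ϕ p (tr ((2 * R * L + j : ℕ) : ℤ) ω) := by
    intro j hj ω
    simp only [hF, dif_pos hj, block, pattern_tr]
    congr 1
    funext i
    rw [Int.toNat_of_nonneg (hpos j hj i).1]
  set W : (Fin ((4 * R + 1) * L) → α) → ZMod (n + 1) → ℝ := fun x y =>
    (1 / (L : ℝ)) * ∑ j ∈ Finset.range L,
      (1 - p * (if y = -((2 * R * L + j : ℕ) : ZMod (n + 1)) then (1 : ℝ) else 0)) * F j x with hW
  have hW0 : ∀ x, ∑ y, W x y = 0 := by
    intro x
    simp only [hW]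
    rw [← Finset.mul_sum, Finset.sum_comm, Finset.sum_eq_zero, mul_zero]
    intro j _
    rw [← Finset.sum_mul, Finset.sum_sub_distrib, ← Finset.mul_sum]
    simp only [Finset.sum_ite_eq', Finset.mem_univ, if_true, Finset.sum_const, Finset.card_univ,
      ZMod.card, nsmul_eq_mul, mul_one, hpdef, sub_self, zero_mul]
  have hW3 : ∀ x y, |W x y| ≤ 3 := by
    intro x y
    -- As `L ≤ p`, at most one `j < L` lies in a given residue class.
    have hcount : ∑ j ∈ Finset.range L,
        (if y = -((2 * R * L + j : ℕ) : ZMod (n + 1)) then (1 : ℝ) else 0) ≤ 1 := by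
      rw [Finset.sum_boole]
      norm_cast
      rw [Finset.card_le_one]
      intro i hi j hj
      simp only [Finset.mem_filter, Finset.mem_range] at hi hj
      have h1 := neg_injective (hi.2.symm.trans hj.2)
      rw [ZMod.natCast_eq_natCast_iff] at h1
      have h2 := Nat.ModEq.add_left_cancel' _ h1
      exact Nat.ModEq.eq_of_lt_of_lt h2 (by omega) (by omega)
    have h1 : |∑ j ∈ Finset.range L, (1 - p * (if y = -((2 * R * L + j : ℕ) : ZMod (n + 1))
        then (1 : ℝ) else 0)) * F j x| ≤ L * 3 := by
      calc _ ≤ ∑ j ∈ Finset.range L, (1 + p * (if y = -((2 * R * L + j : ℕ) : ZMod (n + 1))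
            then (1 : ℝ) else 0)) := by
            refine (Finset.abs_sum_le_sum_abs _ _).trans (Finset.sum_le_sum fun j _ => ?_)
            rw [abs_mul, abs_of_nonneg (hF01 j x).1]
            refine (mul_le_of_le_one_right (abs_nonneg _) (hF01 j x).2).trans ?_
            refine (abs_sub _ _).trans (le_of_eq ?_)
            rw [abs_one, abs_of_nonneg]
            split_ifs <;> positivity
        _ = L + p * ∑ j ∈ Finset.range L, (if y = -((2 * R * L + j : ℕ) : ZMod (n + 1))
            then (1 : ℝ) else 0) := by
            rw [Finset.sum_add_distrib, ← Finset.mul_sum]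
            simp
        _ ≤ L + p * 1 := by gcongr
        _ ≤ L * 3 := by
            have : (p : ℝ) ≤ L * 2 := by exact_mod_cast hpL.le
            linarith
    simp only [hW]
    rw [abs_mul, abs_of_pos (by positivity)]
    rw [one_div, inv_mul_le_iff₀ hLR]
    exact h1
  have key := mul_mean_le_condEnt_sub (M := M) b hp W hW0 hW3 ht ht3
  refine le_trans (le_of_eq ?_) key
  congr 1
  set G : Z × ℤ → ℝ := fun ω =>
    (1 - p * (if (p : ℤ) ∣ ω.2 then (1 : ℝ) else 0)) * pattern b h ϕ p ω with hG
  have hpat : Bdd (pattern b h ϕ p : Z × ℤ → ℝ) := Bdd.of_mem_Icc (pattern_mem_Icc b hϕ p)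
  have hGb : Bdd G := ((Bdd.const 1).sub ((Bdd.ite _).const_mul _)).mul hpat
  have hMG : M G = M (pattern b h ϕ p) - p * M (fun ω => if (p : ℤ) ∣ ω.2 then
      pattern b h ϕ p ω else 0) := by
    have h1 : Bdd fun ω : Z × ℤ => if (p : ℤ) ∣ ω.2 then pattern b h ϕ p ω else 0 := by
      refine Bdd.of_mem_Icc fun ω => ?_
      split_ifs
      · exact pattern_mem_Icc b hϕ p ω
      · simp
    rw [← M.const_mul _ h1, ← M.sub hpat (h1.const_mul _)]
    congr 1
    funext ω
    simp only [hG]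
    split_ifs <;> ring
  have hWG : (fun ω : Z × ℤ => W (block b _ ω) ω.2) = fun ω =>
      (1 / (L : ℝ)) * ∑ j ∈ Finset.range L, G (tr ((2 * R * L + j : ℕ) : ℤ) ω) := by
    funext ω
    simp only [hW, hG]
    congr 1
    refine Finset.sum_congr rfl fun j hj => ?_
    rw [hFblock j (Finset.mem_range.1 hj) ω]
    have : (ω.2 : ZMod (n + 1)) = -((2 * R * L + j : ℕ) : ZMod (n + 1)) ↔
        (p : ℤ) ∣ (tr ((2 * R * L + j : ℕ) : ℤ) ω).2 := by
      rw [eq_neg_iff_add_eq_zero, tr_snd, ← ZMod.intCast_zmod_eq_zero_iff_dvd]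
      push_cast
      rfl
    simp only [this]
  rw [hWG, M.const_mul _ (Bdd.sum _ fun j _ => hGb.comp _), M.sum _ fun j _ => hGb.comp _,
    Finset.sum_congr rfl fun j _ => hM.map_tr _ hGb, ← hMG]
  simp only [Finset.sum_const, Finset.card_range, nsmul_eq_mul]
  field_simp

/-- `∑_{p ≤ P} 1 / p` over the primes. -/
noncomputable def primeSum (P : ℕ) : ℝ := ∑ p ∈ (Finset.Icc 1 P).filter Nat.Prime, 1 / (p : ℝ)

lemma tendsto_primeSum : Tendsto primeSum atTop atTop := by
  have h1 : Tendsto (fun P => ∑ n ∈ Finset.range P,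
      Set.indicator {p : ℕ | p.Prime} (fun n : ℕ => (1 : ℝ) / n) n) atTop atTop := by
    refine (not_summable_iff_tendsto_nat_atTop_of_nonneg fun n => ?_).1
      not_summable_one_div_on_primes
    exact Set.indicator_nonneg (fun _ _ => by positivity) _
  refine ((tendsto_add_atTop_iff_nat 1).2 h1).congr fun P => ?_
  rw [primeSum, Finset.sum_filter, Finset.range_eq_Ico, Finset.sum_eq_sum_Ico_succ_bot (by omega)]
  simp [Set.indicator_apply]
  rfl

/-- A bound for the sum of `1 / n ^ 2` over any set of positive integers. -/
lemma exists_sum_one_div_sq_le : ∃ C : ℝ, 0 ≤ C ∧ ∀ s : Finset ℕ, ∑ n ∈ s, 1 / (n : ℝ) ^ 2 ≤ C := by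
  have hs : Summable fun n : ℕ => 1 / (n : ℝ) ^ 2 := Real.summable_one_div_nat_pow.2 (by norm_num)
  exact ⟨∑' n : ℕ, 1 / (n : ℝ) ^ 2, tsum_nonneg fun n => by positivity,
    fun s => hs.sum_le_tsum s fun n _ => by positivity⟩

/-- If the mean of a nonnegative pattern statistic over the multiples of `p` is `O(1 / p ^ 2)`, then
the logarithmic average over the primes of its mean tends to zero. -/
theorem tendsto_primeLogAvg_pattern [Fintype α] [Finite ι] (hM : M.Invariant)
    (hϕ : ∀ v, ϕ v ∈ Set.Icc (0 : ℝ) 1) {C : ℝ}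
    (hC : ∀ p : ℕ, p.Prime →
      p * M (fun ω => if (p : ℤ) ∣ ω.2 then pattern b h ϕ p ω else 0) ≤ C / p) :
    Tendsto (fun P => primeLogAvg P fun p => M (pattern b h ϕ p)) atTop (𝓝 0) := by
  classical
  obtain ⟨R, hR⟩ : ∃ R : ℕ, ∀ i, |h i| ≤ R := by
    obtain ⟨R, hR⟩ := (Set.finite_range fun i => (h i).natAbs).bddAbove
    refine ⟨R, fun i => ?_⟩
    rw [Int.abs_eq_natAbs]
    exact_mod_cast hR ⟨i, rfl⟩
  obtain ⟨S, hS0, hS⟩ := exists_sum_one_div_sq_le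
  have hbdd : ∀ p : ℤ, Bdd (pattern b h ϕ p : Z × ℤ → ℝ) := fun p =>
    Bdd.of_mem_Icc (pattern_mem_Icc b hϕ p)
  have hnn : ∀ p : ℤ, 0 ≤ M (pattern b h ϕ p) := fun p =>
    M.nonneg (hbdd p) fun ω => (pattern_mem_Icc b hϕ p ω).1
  have hC0 : 0 ≤ C := by
    have h1 : 0 ≤ M (fun ω => if ((2 : ℕ) : ℤ) ∣ ω.2 then pattern b h ϕ (2 : ℕ) ω else 0) := by
      refine M.nonneg (Bdd.of_mem_Icc fun ω => ?_) fun ω => ?_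
      · split_ifs
        · exact pattern_mem_Icc b hϕ _ ω
        · simp
      · split_ifs
        · exact (pattern_mem_Icc b hϕ _ ω).1
        · simp
    have := hC 2 Nat.prime_two
    push_cast at this h1
    linarith
  set A := condEnt M b (4 * R + 1) 0 with hA
  -- The first two terms on the right do not depend on `P`, and `primeSum P` tends to infinity.
  have main : ∀ t : ℝ, 0 < t → t * 3 ≤ 1 → ∀ P : ℕ,
      ∑ p ∈ (Finset.Icc 1 P).filter Nat.Prime, M (pattern b h ϕ p) / p ≤
        A / t + C * S + 9 * t * primeSum P := by
    intro t ht ht3 P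
    have h1 : ∀ n : ℕ, (n + 1).Prime → M (pattern b h ϕ (n + 1 : ℕ)) / (n + 1 : ℕ) ≤
        ((condEnt M b ((4 * R + 1) * 2 ^ Nat.log 2 (n + 1)) n -
        condEnt M b ((4 * R + 1) * 2 ^ Nat.log 2 (n + 1)) (n + 1)) / (n + 1 : ℕ)) / t +
        C * (1 / ((n + 1 : ℕ) : ℝ) ^ 2) + 9 * t * (1 / (n + 1 : ℕ)) := by
      intro n hp
      have h2 := mul_mean_pattern_sub_le b hM hϕ hR hp ht.le ht3
      have h3 := hC (n + 1) hp
      have hn : (0 : ℝ) < (n + 1 : ℕ) := by positivity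
      set D := condEnt M b ((4 * R + 1) * 2 ^ Nat.log 2 (n + 1)) n -
        condEnt M b ((4 * R + 1) * 2 ^ Nat.log 2 (n + 1)) (n + 1) with hD
      have h4 : M (pattern b h ϕ (n + 1 : ℕ)) - C / (n + 1 : ℕ) ≤ D / t + 9 * t := by
        have h5 : t * (M (pattern b h ϕ (n + 1 : ℕ)) - C / (n + 1 : ℕ)) ≤ D + (t * 3) ^ 2 :=
          (mul_le_mul_of_nonneg_left (by linarith) ht.le).trans h2
        have h6 : t * (D / t + 9 * t) = D + (t * 3) ^ 2 := by field_simp; ring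
        exact le_of_mul_le_mul_left (by linarith) ht
      have h7 : M (pattern b h ϕ (n + 1 : ℕ)) / (n + 1 : ℕ) ≤
          (D / t + 9 * t + C / (n + 1 : ℕ)) / (n + 1 : ℕ) :=
        div_le_div_of_nonneg_right (by linarith) hn.le
      refine h7.trans (le_of_eq ?_)
      field_simp
      ring
    have h2 : ∀ f : ℕ → ℝ, ∑ p ∈ (Finset.Icc 1 P).filter Nat.Prime, f p =
        ∑ n ∈ (Finset.range P).filter fun n => (n + 1).Prime, f (n + 1) := by
      intro f
      rw [Finset.sum_filter, Finset.sum_filter, Finset.range_eq_Ico,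
        Finset.sum_Ico_add' (fun p => if p.Prime then f p else 0) 0 P 1]
      rfl
    have h3 := sum_condEnt_drop_le b hM (4 * R + 1) P
    rw [h2 fun p => M (pattern b h ϕ p) / p, primeSum, h2 fun p => 1 / (p : ℝ)]
    calc _ ≤ ∑ n ∈ (Finset.range P).filter fun n => (n + 1).Prime,
          (((condEnt M b ((4 * R + 1) * 2 ^ Nat.log 2 (n + 1)) n -
        condEnt M b ((4 * R + 1) * 2 ^ Nat.log 2 (n + 1)) (n + 1)) / (n + 1 : ℕ)) / t +
        C * (1 / ((n + 1 : ℕ) : ℝ) ^ 2) + 9 * t * (1 / (n + 1 : ℕ))) :=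
          Finset.sum_le_sum fun n hn => h1 n (Finset.mem_filter.1 hn).2
      _ ≤ A / t + C * S + 9 * t * ∑ n ∈ (Finset.range P).filter fun n => (n + 1).Prime,
          (1 / ((n + 1 : ℕ) : ℝ)) := by
        rw [Finset.sum_add_distrib, Finset.sum_add_distrib, ← Finset.sum_div, ← Finset.mul_sum,
          ← Finset.mul_sum]
        gcongr
        · refine le_trans (Finset.sum_le_sum_of_subset_of_nonneg (Finset.filter_subset _ _) ?_) h3
          intro n _ _
          exact div_nonneg (sub_nonneg.2 (condEnt_succ_le b _ n)) (by positivity)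
        · rw [← h2 fun p => 1 / (p : ℝ) ^ 2]
          exact hS _
  rw [Metric.tendsto_nhds]
  intro ε hε
  obtain ⟨t, ht, ht3, ht9⟩ : ∃ t : ℝ, 0 < t ∧ t * 3 ≤ 1 ∧ 9 * t < ε / 2 := by
    refine ⟨min (1 / 3) (ε / 36), by positivity, ?_, ?_⟩
    · have := min_le_left (1 / 3) (ε / 36); linarith
    · have := min_le_right (1 / 3) (ε / 36); linarith
  filter_upwards [tendsto_primeSum.eventually_gt_atTop (2 * (A / t + C * S) / ε),
    tendsto_primeSum.eventually_gt_atTop 0] with P hP hP0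
  rw [Real.dist_eq, sub_zero]
  have h1 := main t ht ht3 P
  change |(∑ p ∈ (Finset.Icc 1 P).filter Nat.Prime, M (pattern b h ϕ p) / p) / primeSum P| < ε
  have h2 : 0 ≤ ∑ p ∈ (Finset.Icc 1 P).filter Nat.Prime, M (pattern b h ϕ p) / p :=
    Finset.sum_nonneg fun p _ => div_nonneg (hnn p) (by positivity)
  rw [abs_of_nonneg (div_nonneg h2 hP0.le), div_lt_iff₀ hP0]
  rw [div_lt_iff₀ hε] at hP
  nlinarith

end Pattern

/-! ### The Turán–Kubilius inequality -/

section TuranKubilius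

variable {Z : Type*} {M : Mean (Z × ℤ)}

lemma mean_dvd (hM : M.Invariant) {N : ℕ} (hN : N ≠ 0) :
    M (fun ω => if (N : ℤ) ∣ ω.2 then (1 : ℝ) else 0) = 1 / N := by
  classical
  have : NeZero N := ⟨hN⟩
  rw [← law_residue hM N 0, law]
  simp only [ZMod.intCast_zmod_eq_zero_iff_dvd]

/-- The number of elements of `s` dividing the second coordinate. -/
def divisorCount (s : Finset ℕ) (ω : Z × ℤ) : ℝ := ∑ p ∈ s, if (p : ℤ) ∣ ω.2 then 1 else 0

lemma bdd_divisorCount (s : Finset ℕ) : Bdd (divisorCount s : Z × ℤ → ℝ) :=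
  Bdd.sum s fun _ _ => Bdd.ite _

/-- The Turán–Kubilius inequality for an invariant mean. -/
lemma mean_sq_divisorCount_sub_le (hM : M.Invariant) (s : Finset ℕ) (hs : ∀ p ∈ s, p.Prime) :
    M (fun ω => (divisorCount s ω - ∑ p ∈ s, 1 / (p : ℝ)) ^ 2) ≤ ∑ p ∈ s, 1 / (p : ℝ) := by
  classical
  set L := ∑ p ∈ s, 1 / (p : ℝ) with hL
  have h1 : M (divisorCount s) = L := by
    change M (fun ω => ∑ p ∈ s, if (p : ℤ) ∣ ω.2 then (1 : ℝ) else 0) = L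
    rw [M.sum s fun _ _ => Bdd.ite _]
    exact Finset.sum_congr rfl fun p hp => mean_dvd hM (hs p hp).ne_zero
  have h2 : M (fun ω => divisorCount s ω * divisorCount s ω) ≤ L ^ 2 + L := by
    have e : (fun ω : Z × ℤ => divisorCount s ω * divisorCount s ω) = fun ω =>
        ∑ p ∈ s, ∑ q ∈ s, (if (p : ℤ) ∣ ω.2 then (1 : ℝ) else 0) *
          (if (q : ℤ) ∣ ω.2 then (1 : ℝ) else 0) := by
      funext ω
      rw [divisorCount, Finset.sum_mul_sum]
    rw [e, M.sum s fun p _ => Bdd.sum s fun q _ => (Bdd.ite _).mul (Bdd.ite _)]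
    calc _ ≤ ∑ p ∈ s, ∑ q ∈ s, (1 / (p : ℝ) * (1 / q) + if q = p then 1 / (p : ℝ) else 0) := by
          refine Finset.sum_le_sum fun p hp => ?_
          rw [M.sum s fun q _ => (Bdd.ite _).mul (Bdd.ite _)]
          refine Finset.sum_le_sum fun q hq => ?_
          rcases eq_or_ne q p with rfl | hqp
          · rw [if_pos rfl]
            have : M (fun ω : Z × ℤ => (if (q : ℤ) ∣ ω.2 then (1 : ℝ) else 0) *
                (if (q : ℤ) ∣ ω.2 then (1 : ℝ) else 0)) = 1 / q := by
              rw [← mean_dvd hM (hs q hq).ne_zero]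
              congr 1
              funext ω
              split_ifs <;> simp
            rw [this]
            have : (0 : ℝ) ≤ 1 / (q : ℝ) * (1 / q) := by positivity
            linarith
          · rw [if_neg hqp, add_zero]
            refine le_of_eq ?_
            have hcop : Nat.Coprime p q := (Nat.coprime_primes (hs p hp) (hs q hq)).2 hqp.symm
            have := mean_dvd hM (Nat.mul_ne_zero (hs p hp).ne_zero (hs q hq).ne_zero)
            rw [Nat.cast_mul, Nat.cast_mul] at this
            rw [one_div_mul_one_div, ← this]
            congr 1
            funext ω
            have hiff : (p : ℤ) * q ∣ ω.2 ↔ (p : ℤ) ∣ ω.2 ∧ (q : ℤ) ∣ ω.2 :=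
              ⟨fun h => ⟨(dvd_mul_right _ _).trans h, (dvd_mul_left _ _).trans h⟩,
                fun h => (Nat.isCoprime_iff_coprime.2 hcop).mul_dvd h.1 h.2⟩
            by_cases h3 : (p : ℤ) ∣ ω.2 <;> by_cases h4 : (q : ℤ) ∣ ω.2 <;> simp [hiff, h3, h4]
      _ = L ^ 2 + L := by
          simp only [Finset.sum_add_distrib, Finset.sum_ite_eq', ← Finset.mul_sum,
            ← Finset.sum_mul, ← hL]
          rw [sq]
          congr 1
          exact Finset.sum_congr rfl fun p hp => by rw [if_pos hp]
  have e : (fun ω : Z × ℤ => (divisorCount s ω - L) ^ 2) = fun ω =>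
      divisorCount s ω * divisorCount s ω - (2 * L * divisorCount s ω - L ^ 2) := by
    funext ω; ring
  have hb := bdd_divisorCount (Z := Z) s
  rw [e, M.sub (hb.mul hb) ((hb.const_mul _).sub (Bdd.const _)),
    M.sub (hb.const_mul _) (Bdd.const _), M.const_mul _ hb, M.const, h1]
  nlinarith

/-- The `L¹` form of the Turán–Kubilius inequality. -/
lemma mean_abs_one_sub_divisorCount_le (hM : M.Invariant) (s : Finset ℕ) (hs : ∀ p ∈ s, p.Prime)
    (h0 : 0 < ∑ p ∈ s, 1 / (p : ℝ)) :
    M (fun ω => |1 - divisorCount s ω / ∑ p ∈ s, 1 / (p : ℝ)|) ≤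
      1 / √(∑ p ∈ s, 1 / (p : ℝ)) := by
  set L := ∑ p ∈ s, 1 / (p : ℝ) with hL
  have hTK := mean_sq_divisorCount_sub_le hM s hs
  rw [← hL] at hTK
  have hb := bdd_divisorCount (Z := Z) s
  have hsq : √L * √L = L := Real.mul_self_sqrt h0.le
  have hs0 : 0 < √L := Real.sqrt_pos.2 h0
  have hb2 : Bdd fun ω : Z × ℤ => (divisorCount s ω - L) ^ 2 := by
    simp only [sq]
    exact (hb.sub (Bdd.const _)).mul (hb.sub (Bdd.const _))
  have hb1 : Bdd fun ω : Z × ℤ => |1 - divisorCount s ω / L| := by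
    simp only [div_eq_inv_mul]
    exact ((Bdd.const 1).sub (hb.const_mul _)).abs
  -- The inequality `u ≤ √L u ^ 2 / 2 + 1 / (2 √L)` balances the two terms.
  have h1 : ∀ ω : Z × ℤ, |1 - divisorCount s ω / L| ≤
      1 / (2 * (√L * L)) * (divisorCount s ω - L) ^ 2 + 1 / (2 * √L) := by
    intro ω
    set u := |1 - divisorCount s ω / L| with hu
    have hu2 : (divisorCount s ω - L) ^ 2 = L ^ 2 * u ^ 2 := by
      rw [hu, sq_abs]; field_simp; ring
    rw [hu2]
    have h2 : 1 / (2 * (√L * L)) * (L ^ 2 * u ^ 2) + 1 / (2 * √L) - u =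
        (√L * u - 1) ^ 2 / (2 * √L) := by
      have h3 : L ^ 2 = L * (√L * √L) := by rw [hsq]; ring
      rw [h3]
      field_simp
      ring
    have h4 : 0 ≤ (√L * u - 1) ^ 2 / (2 * √L) := by positivity
    linarith
  calc _ ≤ M (fun ω => 1 / (2 * (√L * L)) * (divisorCount s ω - L) ^ 2 + 1 / (2 * √L)) :=
        M.mono hb1 ((hb2.const_mul _).add (Bdd.const _)) h1
    _ = 1 / (2 * (√L * L)) * M (fun ω => (divisorCount s ω - L) ^ 2) + 1 / (2 * √L) := by
        rw [M.add (hb2.const_mul _) (Bdd.const _), M.const_mul _ hb2, M.const]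
    _ ≤ 1 / (2 * (√L * L)) * L + 1 / (2 * √L) := by gcongr
    _ = 1 / √L := by field_simp; norm_num

/-- Averages of a bounded function along a window are controlled by the contributions of the
multiples of the primes in `s`. -/
lemma mean_abs_avg_le (hM : M.Invariant) (s : Finset ℕ) (hs : ∀ p ∈ s, p.Prime)
    (h0 : 0 < ∑ p ∈ s, 1 / (p : ℝ)) {g : Z × ℤ → ℝ} (hg : ∀ ω, |g ω| ≤ 1) (u : ℕ → ℤ) {H : ℕ}
    (hH : 0 < H) :
    M (fun ω => |(∑ t ∈ Finset.Icc 1 H, g (tr (u t) ω)) / H|) ≤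
      (∑ p ∈ s, M (fun ω => |(∑ t ∈ Finset.Icc 1 H,
        if (p : ℤ) ∣ (tr (u t) ω).2 then g (tr (u t) ω) else 0) / H|)) /
          (∑ p ∈ s, 1 / (p : ℝ)) + 1 / √(∑ p ∈ s, 1 / (p : ℝ)) := by
  set L := ∑ p ∈ s, 1 / (p : ℝ) with hL
  have hHr : (0 : ℝ) < H := by exact_mod_cast hH
  have hgb : Bdd g := ⟨1, hg⟩
  have hdg : ∀ p : ℕ, Bdd fun ω : Z × ℤ => if (p : ℤ) ∣ ω.2 then g ω else 0 := fun p =>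
    ⟨1, fun ω => by beta_reduce; split_ifs; exacts [hg ω, by simp]⟩
  have hdiv : ∀ {f : Z × ℤ → ℝ} (c : ℝ), Bdd f → Bdd fun ω => f ω / c := fun c hf => by
    simpa only [div_eq_inv_mul] using hf.const_mul _
  have hb1 : Bdd fun ω : Z × ℤ => |1 - divisorCount s ω / L| :=
    ((Bdd.const 1).sub (hdiv _ (bdd_divisorCount s))).abs
  have hb2 : ∀ p : ℕ, Bdd fun ω : Z × ℤ => |(∑ t ∈ Finset.Icc 1 H,
      if (p : ℤ) ∣ (tr (u t) ω).2 then g (tr (u t) ω) else 0) / H| := fun p =>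
    (hdiv _ (Bdd.sum _ fun t _ => (hdg p).comp (tr (u t)))).abs
  have hb3 : Bdd fun ω : Z × ℤ => (∑ p ∈ s, |(∑ t ∈ Finset.Icc 1 H,
      if (p : ℤ) ∣ (tr (u t) ω).2 then g (tr (u t) ω) else 0) / H|) / L :=
    hdiv _ (Bdd.sum _ fun p _ => hb2 p)
  have hb4 : Bdd fun ω : Z × ℤ => (∑ t ∈ Finset.Icc 1 H,
      |1 - divisorCount s (tr (u t) ω) / L|) / H :=
    hdiv _ (Bdd.sum _ fun t _ => hb1.comp (tr (u t)))
  -- Insert the weight `divisorCount s / L`, which is close to one in mean, at every point.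
  have point : ∀ ω : Z × ℤ, |(∑ t ∈ Finset.Icc 1 H, g (tr (u t) ω)) / H| ≤
      (∑ p ∈ s, |(∑ t ∈ Finset.Icc 1 H,
        if (p : ℤ) ∣ (tr (u t) ω).2 then g (tr (u t) ω) else 0) / H|) / L +
      (∑ t ∈ Finset.Icc 1 H, |1 - divisorCount s (tr (u t) ω) / L|) / H := by
    intro ω
    have e : (∑ t ∈ Finset.Icc 1 H, g (tr (u t) ω)) / H =
        (∑ p ∈ s, (∑ t ∈ Finset.Icc 1 H,
          if (p : ℤ) ∣ (tr (u t) ω).2 then g (tr (u t) ω) else 0) / H) / L +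
        (∑ t ∈ Finset.Icc 1 H, (1 - divisorCount s (tr (u t) ω) / L) * g (tr (u t) ω)) / H := by
      have e1 : ∑ p ∈ s, (∑ t ∈ Finset.Icc 1 H,
          if (p : ℤ) ∣ (tr (u t) ω).2 then g (tr (u t) ω) else 0) / (H : ℝ) =
          (∑ t ∈ Finset.Icc 1 H, divisorCount s (tr (u t) ω) * g (tr (u t) ω)) / H := by
        rw [← Finset.sum_div, Finset.sum_comm]
        congr 1
        refine Finset.sum_congr rfl fun t _ => ?_
        rw [divisorCount, Finset.sum_mul]
        exact Finset.sum_congr rfl fun p _ => by split_ifs <;> simp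
      rw [e1, div_right_comm, ← add_div]
      congr 1
      rw [Finset.sum_div, ← Finset.sum_add_distrib]
      exact Finset.sum_congr rfl fun t _ => by ring
    rw [e]
    refine (abs_add_le _ _).trans (add_le_add ?_ ?_)
    · rw [abs_div, abs_of_pos h0]
      gcongr
      exact Finset.abs_sum_le_sum_abs _ _
    · rw [abs_div, abs_of_pos hHr]
      gcongr
      refine (Finset.abs_sum_le_sum_abs _ _).trans (Finset.sum_le_sum fun t _ => ?_)
      rw [abs_mul]
      exact mul_le_of_le_one_right (abs_nonneg _) (hg _)
  have hgsum : Bdd fun ω : Z × ℤ => |(∑ t ∈ Finset.Icc 1 H, g (tr (u t) ω)) / H| :=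
    (hdiv _ (Bdd.sum _ fun t _ => hgb.comp (tr (u t)))).abs
  refine (M.mono hgsum (hb3.add hb4) point).trans ?_
  rw [M.add hb3 hb4]
  refine add_le_add (le_of_eq ?_) ?_
  · simp only [div_eq_inv_mul _ L]
    rw [M.const_mul _ (Bdd.sum _ fun p _ => hb2 p), M.sum _ fun p _ => hb2 p]
  · simp only [div_eq_inv_mul _ (H : ℝ)]
    rw [M.const_mul _ (Bdd.sum _ fun t _ => hb1.comp (tr (u t))),
      M.sum _ fun t _ => hb1.comp (tr (u t)),
      Finset.sum_congr rfl fun t _ => hM.map_tr (u t) hb1]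
    simp only [Finset.sum_const, Nat.card_Icc, add_tsub_cancel_right, nsmul_eq_mul]
    rw [inv_mul_cancel_left₀ hHr.ne']
    exact mean_abs_one_sub_divisorCount_le hM s hs h0

/-- To prove that window averages of a bounded function tend to zero in mean, it is enough to bound
the contribution of the multiples of each large prime `p` by `O(1 / p ^ 2)` in the limit. -/
theorem tendsto_mean_abs_avg (hM : M.Invariant) {g : Z × ℤ → ℝ} (hg : ∀ ω, |g ω| ≤ 1)
    (u : ℕ → ℤ) (Q : ℕ) {C : ℝ} (hC : 0 ≤ C)
    (h : ∀ p : ℕ, p.Prime → Q < p → ∀ ε > 0, ∀ᶠ H : ℕ in atTop,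
      M (fun ω => |(∑ t ∈ Finset.Icc 1 H,
        if (p : ℤ) ∣ (tr (u t) ω).2 then g (tr (u t) ω) else 0) / H|) ≤ C / p ^ 2 + ε) :
    Tendsto (fun H : ℕ => M (fun ω => |(∑ t ∈ Finset.Icc 1 H, g (tr (u t) ω)) / H|)) atTop
      (𝓝 0) := by
  have hdiv : ∀ {f : Z × ℤ → ℝ} (c : ℝ), Bdd f → Bdd fun ω => f ω / c := fun c hf => by
    simpa only [div_eq_inv_mul] using hf.const_mul _
  obtain ⟨S, hS0, hS⟩ := exists_sum_one_div_sq_le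
  rw [Metric.tendsto_nhds]
  intro ε hε
  obtain ⟨P, hP⟩ : ∃ P, max (max (2 * (C * S + 1) / ε) (16 / ε ^ 2)) 1 + primeSum Q < primeSum P :=
    (tendsto_primeSum.eventually_gt_atTop _).exists
  -- The primes in `(Q, P]`, with `P` so large that the sum of their reciprocals is large.
  set s := ((Finset.Icc 1 P).filter Nat.Prime).filter fun p => Q < p with hs
  set L := ∑ p ∈ s, 1 / (p : ℝ) with hL
  have hsp : ∀ p ∈ s, p.Prime ∧ Q < p := by
    intro p hp
    simp only [hs, Finset.mem_filter] at hp
    exact ⟨hp.1.2, hp.2⟩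
  have hLlow : primeSum P ≤ L + primeSum Q := by
    rw [hL, primeSum, ← Finset.sum_filter_add_sum_filter_not _ fun p => Q < p]
    refine add_le_add le_rfl (Finset.sum_le_sum_of_subset_of_nonneg ?_ fun _ _ _ => by positivity)
    intro p hp
    simp only [Finset.mem_filter, Finset.mem_Icc] at hp ⊢
    exact ⟨⟨hp.1.1.1, by omega⟩, hp.1.2⟩
  have hL1 : max (max (2 * (C * S + 1) / ε) (16 / ε ^ 2)) 1 < L := by linarith
  rw [max_lt_iff, max_lt_iff] at hL1
  obtain ⟨⟨hLa, hLb⟩, hLc⟩ := hL1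
  have hL0 : 0 < L := by linarith
  have hs0 : 0 < √L := Real.sqrt_pos.2 hL0
  have hev : ∀ᶠ H : ℕ in atTop, ∀ p ∈ s, M (fun ω => |(∑ t ∈ Finset.Icc 1 H,
        if (p : ℤ) ∣ (tr (u t) ω).2 then g (tr (u t) ω) else 0) / H|) ≤
        C / p ^ 2 + 1 / (s.card + 1) := by
    rw [Filter.eventually_all_finset]
    exact fun p hp => h p (hsp p hp).1 (hsp p hp).2 _ (by positivity)
  filter_upwards [hev, eventually_gt_atTop 0] with H hH hH0
  have hnn : 0 ≤ M (fun ω => |(∑ t ∈ Finset.Icc 1 H, g (tr (u t) ω)) / H|) :=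
    M.nonneg (hdiv _ (Bdd.sum _ fun t _ => Bdd.comp ⟨1, hg⟩ (tr (u t)))).abs fun _ => abs_nonneg _
  rw [Real.dist_eq, sub_zero, abs_of_nonneg hnn]
  have h1 := mean_abs_avg_le hM s (fun p hp => (hsp p hp).1) hL0 hg u hH0
  have h2 : ∑ p ∈ s, M (fun ω => |(∑ t ∈ Finset.Icc 1 H,
        if (p : ℤ) ∣ (tr (u t) ω).2 then g (tr (u t) ω) else 0) / H|) ≤ C * S + 1 := by
    refine (Finset.sum_le_sum hH).trans ?_
    rw [Finset.sum_add_distrib]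
    refine add_le_add ?_ ?_
    · simp only [div_eq_mul_one_div C, ← Finset.mul_sum]
      exact mul_le_mul_of_nonneg_left (hS s) hC
    · rw [Finset.sum_const, nsmul_eq_mul, mul_one_div, div_le_one (by positivity)]
      linarith
  have h3 : (∑ p ∈ s, M (fun ω => |(∑ t ∈ Finset.Icc 1 H,
        if (p : ℤ) ∣ (tr (u t) ω).2 then g (tr (u t) ω) else 0) / H|)) / L < ε / 2 := by
    rw [div_lt_iff₀ hL0]
    rw [div_lt_iff₀ hε] at hLa
    linarith
  have h4 : 1 / √L < ε / 2 := by
    rw [div_lt_iff₀ hs0]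
    have : 2 / ε < √L := by
      apply Real.lt_sqrt_of_sq_lt
      refine lt_of_le_of_lt ?_ hLb
      rw [div_pow]
      gcongr
      norm_num
    rw [div_lt_iff₀ hε] at this
    linarith
  linarith

/-- A function with values in `[0, 1]` whose mean over the multiples of each prime `p` is
`O(1 / p ^ 2)` has mean zero. -/
lemma mean_eq_zero_of_primes (hM : M.Invariant) {f : Z × ℤ → ℝ}
    (hf : ∀ ω, f ω ∈ Set.Icc (0 : ℝ) 1) {C : ℝ} (hC : 0 ≤ C)
    (h : ∀ p : ℕ, p.Prime → M (fun ω => if (p : ℤ) ∣ ω.2 then f ω else 0) ≤ C / p ^ 2) :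
    M f = 0 := by
  have key := tendsto_mean_abs_avg hM (g := f)
    (fun ω => by rw [abs_of_nonneg (hf ω).1]; exact (hf ω).2) (fun _ => 0) 0 hC ?_
  · refine tendsto_nhds_unique (tendsto_const_nhds.congr' ?_) key
    filter_upwards [eventually_gt_atTop 0] with H hH
    congr 1
    funext ω
    have hH' : (H : ℝ) ≠ 0 := by positivity
    simp [tr, hH', abs_of_nonneg (hf ω).1]
  · intro p hp _ ε hε
    filter_upwards [eventually_gt_atTop 0] with H hH
    refine le_trans (le_of_eq ?_) ((h p hp).trans (by linarith))
    congr 1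
    funext ω
    have hH' : (H : ℝ) ≠ 0 := by positivity
    simp only [tr, add_zero, Prod.mk.eta, Finset.sum_const, Nat.card_Icc, add_tsub_cancel_right,
      nsmul_eq_mul]
    rw [mul_div_cancel_left₀ _ hH', abs_of_nonneg]
    split_ifs
    exacts [(hf ω).1, le_rfl]

end TuranKubilius

/-! ### Limits of averages along an ultrafilter -/

section LimMean

/-- The average of `f (x, n)` over `1 ≤ n ≤ x`, normalised by the number of terms (and equal to zero
for `x < 1`). -/
noncomputable def intervalAvg (f : ℝ × ℤ → ℝ) (x : ℝ) : ℝ :=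
  (∑ n ∈ Finset.Icc 1 ⌊x⌋₊, f (x, (n : ℤ))) / ⌊x⌋₊

lemma abs_intervalAvg_le {f : ℝ × ℤ → ℝ} {C : ℝ} (hf : ∀ ω, |f ω| ≤ C) (x : ℝ) :
    |intervalAvg f x| ≤ C := by
  have hC : 0 ≤ C := (abs_nonneg _).trans (hf (0, 0))
  rw [intervalAvg, abs_div, Nat.abs_cast]
  refine div_le_of_le_mul₀ (by positivity) hC ?_
  refine (Finset.abs_sum_le_sum_abs _ _).trans ((Finset.sum_le_sum fun n _ => hf _).trans ?_)
  simp [mul_comm]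

variable (U : Ultrafilter ℝ)

lemma exists_tendsto_intervalAvg {f : ℝ × ℤ → ℝ} (hf : Bdd f) :
    ∃ l, Tendsto (intervalAvg f) U (𝓝 l) := by
  obtain ⟨C, hC⟩ := hf
  have hK : IsCompact (Set.Icc (-C) C) := isCompact_Icc
  obtain ⟨l, -, hl⟩ := hK.ultrafilter_le_nhds (U.map (intervalAvg f)) (by
    rw [le_principal_iff, Ultrafilter.mem_coe, Ultrafilter.mem_map]
    exact Filter.univ_mem' fun x => abs_le.1 (abs_intervalAvg_le hC x))
  exact ⟨l, hl⟩

lemma tendsto_limUnder_intervalAvg {f : ℝ × ℤ → ℝ} (hf : Bdd f) :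
    Tendsto (intervalAvg f) U (𝓝 (limUnder (U : Filter ℝ) (intervalAvg f))) :=
  tendsto_nhds_limUnder (exists_tendsto_intervalAvg U hf)

/-- The limit along an ultrafilter of the averages over `1 ≤ n ≤ x`, as a mean on `ℝ × ℤ`. -/
noncomputable def limMean (hU : (U : Filter ℝ) ≤ atTop) : Mean (ℝ × ℤ) where
  toFun f := limUnder (U : Filter ℝ) (intervalAvg f)
  map_add' f g hf hg := by
    refine (((tendsto_limUnder_intervalAvg U hf).add (tendsto_limUnder_intervalAvg U hg)).congr
      fun x => ?_).limUnder_eq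
    simp only [intervalAvg, Finset.sum_add_distrib, add_div]
  map_const_mul' c f hf := by
    refine (((tendsto_limUnder_intervalAvg U hf).const_mul c).congr fun x => ?_).limUnder_eq
    simp only [intervalAvg, ← Finset.mul_sum, mul_div_assoc]
  map_nonneg' f hf h := ge_of_tendsto' (tendsto_limUnder_intervalAvg U hf) fun x =>
    div_nonneg (Finset.sum_nonneg fun n _ => h _) (by positivity)
  map_one' := by
    refine (tendsto_const_nhds.congr' ?_).limUnder_eq
    filter_upwards [hU (eventually_ge_atTop (1 : ℝ))] with x hx
    have : 0 < ⌊x⌋₊ := Nat.floor_pos.2 hx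
    simp only [intervalAvg, Finset.sum_const, Nat.card_Icc, add_tsub_cancel_right, nsmul_eq_mul,
      mul_one]
    rw [div_self (by positivity)]

variable {U} (hU : (U : Filter ℝ) ≤ atTop)

lemma tendsto_limMean {f : ℝ × ℤ → ℝ} (hf : Bdd f) :
    Tendsto (intervalAvg f) U (𝓝 (limMean U hU f)) := tendsto_limUnder_intervalAvg U hf

lemma limMean_invariant : (limMean U hU).Invariant := by
  intro f hf
  have hf' := hf
  obtain ⟨C, hC⟩ := hf
  refine tendsto_nhds_unique (tendsto_limMean hU (hf'.comp (tr 1))) ?_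
  have h0 : Tendsto (fun x : ℝ => (f (x, (⌊x⌋₊ : ℤ) + 1) - f (x, 1)) / ⌊x⌋₊) U (𝓝 0) := by
    have h1 : Tendsto (fun x : ℝ => (2 * C) / (⌊x⌋₊ : ℝ)) U (𝓝 0) :=
      (tendsto_const_nhds.div_atTop
        (tendsto_natCast_atTop_atTop.comp tendsto_nat_floor_atTop)).mono_left hU
    refine squeeze_zero_norm (fun x => ?_) h1
    rw [Real.norm_eq_abs, abs_div, Nat.abs_cast]
    gcongr
    refine (abs_sub _ _).trans ?_
    linarith [hC (x, (⌊x⌋₊ : ℤ) + 1), hC (x, 1)]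
  have h2 := (tendsto_limMean hU hf').add h0
  rw [add_zero] at h2
  refine h2.congr fun x => ?_
  simp only [intervalAvg, ← add_div]
  congr 1
  have : ∀ N : ℕ, ∑ n ∈ Finset.Icc 1 N, f (x, (n : ℤ)) + (f (x, (N : ℤ) + 1) - f (x, 1)) =
      ∑ n ∈ Finset.Icc 1 N, f (tr 1 (x, (n : ℤ))) := by
    intro N
    induction N with
    | zero => simp
    | succ N ih =>
      rw [Finset.sum_Icc_succ_top (by omega), Finset.sum_Icc_succ_top (by omega), ← ih]
      simp only [tr]
      push_cast
      ring
  exact this _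

/-- The mean of a dilate, over the multiples of `p`, of a nonnegative function: the quotients
`n / p` with `n ≤ x` are among the integers up to `x`. -/
lemma limMean_dilate_le {g : ℝ × ℤ → ℝ} (hg : Bdd g) (hg0 : ∀ ω, 0 ≤ g ω) {p : ℕ} (hp : 0 < p) :
    limMean U hU (fun ω => if (p : ℤ) ∣ ω.2 then g (ω.1, ω.2 / p) else 0) ≤ limMean U hU g := by
  have hb : Bdd fun ω : ℝ × ℤ => if (p : ℤ) ∣ ω.2 then g (ω.1, ω.2 / p) else 0 := by
    obtain ⟨C, hC⟩ := hg
    refine ⟨C, fun ω => ?_⟩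
    beta_reduce
    split_ifs
    · exact hC _
    · rw [abs_zero]; exact (abs_nonneg _).trans (hC (0, 0))
  refine le_of_tendsto_of_tendsto' (tendsto_limMean hU hb) (tendsto_limMean hU hg) fun x => ?_
  refine div_le_div_of_nonneg_right ?_ (by positivity)
  rw [← Finset.sum_filter (fun n : ℕ => (p : ℤ) ∣ (n : ℤ)) fun n : ℕ => g (x, (n : ℤ) / p)]
  have hinj : Set.InjOn (fun n : ℕ => n / p)
      ((Finset.Icc 1 ⌊x⌋₊).filter fun n : ℕ => (p : ℤ) ∣ (n : ℤ)) := by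
    intro a ha b hb hab
    simp only [Finset.coe_filter, Set.mem_ofPred_eq, Int.natCast_dvd_natCast] at ha hb hab
    rw [← Nat.div_mul_cancel ha.2, hab, Nat.div_mul_cancel hb.2]
  have himg := Finset.sum_image (f := fun n : ℕ => g (x, (n : ℤ))) hinj
  simp only [Int.natCast_ediv] at himg
  rw [← himg]
  refine Finset.sum_le_sum_of_subset_of_nonneg ?_ fun _ _ _ => hg0 _
  intro m hm
  simp only [Finset.mem_image, Finset.mem_filter, Finset.mem_Icc, Int.natCast_dvd_natCast] at hm
  obtain ⟨n, ⟨⟨h1, h2⟩, h3⟩, rfl⟩ := hm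
  exact Finset.mem_Icc.2 ⟨Nat.div_pos (Nat.le_of_dvd h1 h3) hp, (Nat.div_le_self _ _).trans h2⟩

/-- Density zero along the ultrafilter, in terms of the mean. -/
lemma limMean_eq_zero_of_density {S : Set ℕ} (hS : Tendsto (densityUpTo S) U (𝓝 0))
    {f : ℝ × ℤ → ℝ} (hf : ∀ ω, f ω ∈ Set.Icc (0 : ℝ) 1)
    (hfS : ∀ x, ∀ n : ℕ, f (x, n) ≠ 0 → n ∈ S) : limMean U hU f = 0 := by
  classical
  have h1 : Tendsto (fun x : ℝ => (densityUpTo S x) / (⌊x⌋₊ / x)) U (𝓝 0) := by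
    have := hS.div (tendsto_nat_floor_div_atTop.mono_left hU) one_ne_zero
    rwa [zero_div] at this
  refine tendsto_nhds_unique (tendsto_limMean hU (Bdd.of_mem_Icc hf)) ?_
  refine squeeze_zero' (Eventually.of_forall fun x => div_nonneg
    (Finset.sum_nonneg fun n _ => (hf _).1) (by positivity)) ?_ h1
  filter_upwards [hU (eventually_ge_atTop (1 : ℝ))] with x hx
  have hx0 : 0 < x := by linarith
  have hfl : 0 < ⌊x⌋₊ := Nat.floor_pos.2 hx
  rw [densityUpTo, div_div_div_cancel_right₀ hx0.ne', intervalAvg]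
  gcongr
  have hset : S ∩ {n : ℕ | 1 ≤ n ∧ (n : ℝ) ≤ x} =
      ((Finset.Icc 1 ⌊x⌋₊).filter fun n => n ∈ S : Finset ℕ) := by
    ext n
    simp only [Set.mem_inter_iff, Set.mem_ofPred_eq, Finset.coe_filter, Finset.mem_Icc,
      Nat.le_floor_iff hx0.le]
    tauto
  rw [hset, Set.ncard_coe_finset, Finset.card_filter, Nat.cast_sum]
  refine Finset.sum_le_sum fun n _ => ?_
  by_cases hn : n ∈ S
  · simpa [hn] using (hf _).2
  · have : f (x, n) = 0 := by
      by_contra h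
      exact hn (hfS x n h)
    simp [hn, this]

end LimMean

/-! ### Transfer between a weakly stable set and its dilates -/

section Transfer

variable {U : Ultrafilter ℝ} (hU : (U : Filter ℝ) ≤ atTop) {k : ℕ}

open Classical in
/-- The letter at the integer `n` of a family of sets of natural numbers: which of the sets
contain `n`. No set contains a negative integer. -/
noncomputable def letter (A : Fin k → Set ℕ) (n : ℤ) : Fin k → Bool :=
  fun j => decide (∃ m ∈ A j, (m : ℤ) = n)

lemma letter_natCast (A : Fin k → Set ℕ) (n : ℕ) (j : Fin k) :
    letter A n j = true ↔ n ∈ A j := by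
  simp [letter]

/-- The letter of the family `B x` at `n`, for the position `(x, n)`. -/
noncomputable def dilLetter (B : Fin k → ℝ → Set ℕ) (ω : ℝ × ℤ) : Fin k → Bool :=
  letter (fun j => B j ω.1) ω.2

/-- Weak stability of all members of a family at once, in terms of letters. -/
lemma limMean_ne_of_not_dvd {A : Fin k → Set ℕ} {B : Fin k → ℝ → Set ℕ}
    (hAB : ∀ j, Corresponds (B j) (A j)) {p : ℕ} (hp : p.Prime) :
    limMean U hU (fun ω => if ¬ (p : ℤ) ∣ ω.2 ∧ dilLetter B (ω.1, p * ω.2) ≠ letter A ω.2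
      then 1 else 0) = 0 := by
  classical
  refine tendsto_nhds_unique (tendsto_limMean hU (Bdd.ite _)) ?_
  have h1 := tendsto_finsetSum (Finset.univ : Finset (Fin k))
    fun j _ => (hAB j p hp).mono_left hU
  rw [Finset.sum_const_zero] at h1
  refine squeeze_zero (fun x => div_nonneg (Finset.sum_nonneg fun n _ => ?_) (by positivity))
    (fun x => ?_) h1
  · beta_reduce
    split_ifs <;> simp
  have point : ∀ n : ℕ, (if ¬ (p : ℤ) ∣ (n : ℤ) ∧ dilLetter B (x, p * (n : ℤ)) ≠ letter A n
      then (1 : ℝ) else 0) ≤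
      ∑ j, if ¬ p ∣ n then |ind (A j) n - ind (B j x) (p * n)| else 0 := by
    intro n
    split_ifs with h h'
    · exact absurd (Int.natCast_dvd_natCast.2 h') h.1
    · obtain ⟨j, hj⟩ := Function.ne_iff.1 h.2
      refine le_trans (le_of_eq ?_) (Finset.single_le_sum (fun i _ => abs_nonneg
        (ind (A i) n - ind (B i x) (p * n))) (Finset.mem_univ j))
      have e1 : dilLetter B (x, p * (n : ℤ)) j = true ↔ p * n ∈ B j x := by
        rw [← letter_natCast (fun j => B j x)]
        simp [dilLetter]
      have e2 := letter_natCast A n j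
      by_cases hA : n ∈ A j <;> by_cases hB : p * n ∈ B j x <;>
        simp only [hA, hB, iff_true, iff_false, Bool.not_eq_true] at e1 e2 <;>
        simp_all [ind]
    · exact Finset.sum_nonneg fun _ _ => le_rfl
    · exact Finset.sum_nonneg fun _ _ => abs_nonneg _
  calc intervalAvg _ x ≤ (∑ n ∈ Finset.Icc 1 ⌊x⌋₊,
        ∑ j, if ¬ p ∣ n then |ind (A j) n - ind (B j x) (p * n)| else 0) / ⌊x⌋₊ :=
        div_le_div_of_nonneg_right (Finset.sum_le_sum fun n _ => point n) (by positivity)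
    _ = ∑ j, (∑ n ∈ (Finset.Icc 1 ⌊x⌋₊).filter fun n => ¬ p ∣ n,
          |ind (A j) n - ind (B j x) (p * n)|) / ⌊x⌋₊ := by
        rw [Finset.sum_comm, Finset.sum_div]
        simp only [Finset.sum_filter]
    _ ≤ _ := by
        refine Finset.sum_le_sum fun j _ => ?_
        rw [Finset.expect_eq_sum_div_card]
        rcases Finset.eq_empty_or_nonempty ((Finset.Icc 1 ⌊x⌋₊).filter fun n => ¬ p ∣ n) with h | h
        · simp [h]
        · refine div_le_div_of_nonneg_left (Finset.sum_nonneg fun _ _ => abs_nonneg _)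
            (by exact_mod_cast h.card_pos) ?_
          have := Finset.card_filter_le (Finset.Icc 1 ⌊x⌋₊) fun n => ¬ p ∣ n
          rw [Nat.card_Icc, add_tsub_cancel_right] at this
          exact_mod_cast this

/-- On the multiples of `p`, the letter of `B x` at `n` is the letter of `A` at `n / p`, except for
a set of measure at most `1 / p ^ 2`, the multiples of `p ^ 2`. -/
lemma limMean_ne_le {A : Fin k → Set ℕ} {B : Fin k → ℝ → Set ℕ}
    (hAB : ∀ j, Corresponds (B j) (A j)) {p : ℕ} (hp : p.Prime) :
    limMean U hU (fun ω => if (p : ℤ) ∣ ω.2 ∧ dilLetter B ω ≠ letter A (ω.2 / p) then 1 else 0) ≤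
      1 / p ^ 2 := by
  classical
  set D : ℝ × ℤ → ℝ := fun ω =>
    if ¬ (p : ℤ) ∣ ω.2 ∧ dilLetter B (ω.1, p * ω.2) ≠ letter A ω.2 then 1 else 0 with hD
  have hD01 : ∀ ω, D ω ∈ Set.Icc (0 : ℝ) 1 := fun ω => by
    simp only [hD]; split_ifs <;> simp
  have h1 := limMean_dilate_le hU (Bdd.of_mem_Icc hD01) (fun ω => (hD01 ω).1) hp.pos
  rw [limMean_ne_of_not_dvd hU hAB hp] at h1
  have h2 := mean_dvd (limMean_invariant hU) (N := p ^ 2) (pow_ne_zero 2 hp.ne_zero)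
  have hb : Bdd fun ω : ℝ × ℤ => if (p : ℤ) ∣ ω.2 then D (ω.1, ω.2 / p) else 0 := by
    refine Bdd.of_mem_Icc fun ω => ?_
    split_ifs
    exacts [hD01 _, by simp]
  have h3 : ∀ ω : ℝ × ℤ,
      (if (p : ℤ) ∣ ω.2 ∧ dilLetter B ω ≠ letter A (ω.2 / p) then (1 : ℝ) else 0) ≤
      (if (p : ℤ) ∣ ω.2 then D (ω.1, ω.2 / p) else 0) +
        (if ((p ^ 2 : ℕ) : ℤ) ∣ ω.2 then 1 else 0) := by
    rintro ⟨x, n⟩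
    by_cases h : (p : ℤ) ∣ n ∧ dilLetter B (x, n) ≠ letter A (n / p)
    · obtain ⟨⟨m, rfl⟩, hne⟩ := h
      have hp0 : (p : ℤ) ≠ 0 := by exact_mod_cast hp.ne_zero
      simp only [dvd_mul_right, true_and, if_true, hD, Int.mul_ediv_cancel_left _ hp0] at hne ⊢
      rw [if_pos hne]
      by_cases hm : (p : ℤ) ∣ m
      · have : ((p ^ 2 : ℕ) : ℤ) ∣ p * m := by
          push_cast
          rw [sq]
          exact mul_dvd_mul_left _ hm
        rw [if_pos this]
        simp [hm]
      · simp only [hm, not_false_eq_true, true_and, if_pos hne]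
        split_ifs <;> norm_num
    · rw [if_neg h]
      refine add_nonneg ?_ ?_ <;> split_ifs
      exacts [(hD01 _).1, le_rfl, zero_le_one, le_rfl]
  have h4 := (limMean U hU).mono (Bdd.ite _) (hb.add (Bdd.ite _)) h3
  rw [(limMean U hU).add hb (Bdd.ite _), h2] at h4
  push_cast at h4
  linarith

/-- Transfer of pattern statistics: over the multiples of `p`, the pattern of `B x` with shifts
`p * h i` at `n` is the pattern of `A` with shifts `h i` at `n / p`, up to `O(1 / p ^ 2)`. -/
lemma limMean_pattern_le {A : Fin k → Set ℕ} {B : Fin k → ℝ → Set ℕ}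
    (hAB : ∀ j, Corresponds (B j) (A j)) {ι : Type*} [Fintype ι] (h : ι → ℤ)
    {ϕ : (ι → Fin k → Bool) → ℝ} (hϕ : ∀ v, ϕ v ∈ Set.Icc (0 : ℝ) 1) {p : ℕ} (hp : p.Prime) :
    limMean U hU (fun ω => if (p : ℤ) ∣ ω.2 then pattern (dilLetter B) h ϕ p ω else 0) ≤
      limMean U hU (fun ω => ϕ fun i => letter A (ω.2 + h i)) + Fintype.card ι / p ^ 2 := by
  classical
  set M := limMean U hU with hMdef
  set E : ℝ × ℤ → ℝ := fun ω =>
    if (p : ℤ) ∣ ω.2 ∧ dilLetter B ω ≠ letter A (ω.2 / p) then 1 else 0 with hE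
  have hEb : Bdd E := Bdd.ite _
  have hE0 : ∀ ω, 0 ≤ E ω := fun ω => by simp only [hE]; split_ifs <;> simp
  set G : ℝ × ℤ → ℝ := fun ω => ϕ fun i => letter A (ω.2 + h i) with hG
  have hGb : Bdd G := Bdd.of_mem_Icc fun ω => hϕ _
  have hb1 : Bdd fun ω : ℝ × ℤ => if (p : ℤ) ∣ ω.2 then G (ω.1, ω.2 / p) else 0 := by
    refine Bdd.of_mem_Icc fun ω => ?_
    split_ifs
    exacts [hϕ _, by simp]
  have hb2 : Bdd fun ω : ℝ × ℤ =>
      if (p : ℤ) ∣ ω.2 then pattern (dilLetter B) h ϕ p ω else 0 := by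
    refine Bdd.of_mem_Icc fun ω => ?_
    split_ifs
    exacts [hϕ _, by simp]
  have hp0 : (p : ℤ) ≠ 0 := by exact_mod_cast hp.ne_zero
  have point : ∀ ω : ℝ × ℤ, (if (p : ℤ) ∣ ω.2 then pattern (dilLetter B) h ϕ p ω else 0) ≤
      (if (p : ℤ) ∣ ω.2 then G (ω.1, ω.2 / p) else 0) + ∑ i, E (tr (p * h i) ω) := by
    intro ω
    by_cases hd : (p : ℤ) ∣ ω.2
    · rw [if_pos hd, if_pos hd]
      by_cases hne : ∃ i, dilLetter B (tr (p * h i) ω) ≠ letter A (ω.2 / p + h i)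
      · obtain ⟨i, hi⟩ := hne
        have h1 : E (tr (p * h i) ω) = 1 := by
          refine if_pos ⟨hd.add (dvd_mul_right _ _), ?_⟩
          rwa [tr_snd, Int.add_mul_ediv_left _ _ hp0]
        have h2 := Finset.single_le_sum (fun i _ => hE0 (tr (p * h i) ω)) (Finset.mem_univ i)
        have h3 : pattern (dilLetter B) h ϕ p ω ≤ 1 := (hϕ _).2
        have h4 : 0 ≤ G (ω.1, ω.2 / p) := (hϕ _).1
        linarith
      · push Not at hne
        have : pattern (dilLetter B) h ϕ p ω = G (ω.1, ω.2 / p) := by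
          simp only [pattern, hG, hne]
        rw [this]
        exact le_add_of_nonneg_right (Finset.sum_nonneg fun i _ => hE0 _)
    · rw [if_neg hd, if_neg hd, zero_add]
      exact Finset.sum_nonneg fun i _ => hE0 _
  have h1 := M.mono hb2 (hb1.add (Bdd.sum _ fun i _ => hEb.comp (tr (p * h i)))) point
  rw [M.add hb1 (Bdd.sum _ fun i _ => hEb.comp (tr (p * h i))),
    M.sum _ fun i _ => hEb.comp (tr (p * h i)),
    Finset.sum_congr rfl fun i _ => (limMean_invariant hU).map_tr (p * h i) hEb] at h1
  have h2 := limMean_dilate_le hU hGb (fun ω => (hϕ _).1) hp.pos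
  have h3 := limMean_ne_le hU hAB hp
  have h4 : ∑ _i : ι, M E ≤ Fintype.card ι / p ^ 2 := by
    rw [Finset.sum_const, nsmul_eq_mul, Finset.card_univ, div_eq_mul_one_div]
    gcongr
  linarith

end Transfer

/-! ### Uniform distribution in short intervals -/

section ShortIntervals

/-- The set `A ∩ [y, y + H] ∩ (qℤ + b)`. -/
def window (A : Set ℕ) (b q : ℕ) (H y : ℝ) : Set ℕ :=
  A ∩ {n : ℕ | y ≤ (n : ℝ) ∧ (n : ℝ) ≤ y + H ∧ n ≡ b [MOD q]}

/-- The discrepancy of `A` in the window `[y, y + H] ∩ (qℤ + b)`. -/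
noncomputable def discrepancy (A : Set ℕ) (δ : ℝ) (b q : ℕ) (H y : ℝ) : ℝ :=
  |((window A b q H y).ncard : ℝ) / H - δ / q|

lemma ncard_window_le (A : Set ℕ) (b q : ℕ) {H y : ℝ} (hH : 0 ≤ H) (hy : 0 ≤ y) :
    ((window A b q H y).ncard : ℝ) ≤ H + 1 := by
  have hsub : window A b q H y ⊆ (Finset.Icc ⌈y⌉₊ ⌊y + H⌋₊ : Finset ℕ) := by
    rintro n ⟨-, h1, h2, -⟩
    rw [Finset.coe_Icc]
    exact ⟨Nat.ceil_le.2 h1, Nat.le_floor h2⟩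
  have h1 := Set.ncard_le_ncard hsub (Finset.finite_toSet _)
  rw [Set.ncard_coe_finset, Nat.card_Icc] at h1
  have h2 : ((window A b q H y).ncard : ℝ) ≤ ((⌊y + H⌋₊ + 1 - ⌈y⌉₊ : ℕ) : ℝ) := by
    exact_mod_cast h1
  refine h2.trans ?_
  rcases le_total ⌈y⌉₊ (⌊y + H⌋₊ + 1) with h | h
  · rw [Nat.cast_sub h]
    have h3 := Nat.floor_le (add_nonneg hy hH)
    have h4 := Nat.le_ceil y
    push_cast
    linarith
  · rw [Nat.sub_eq_zero_of_le h]
    push_cast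
    linarith

/-- On `[0, x]` the number of elements of the window at `y` is a finite sum of indicators of
intervals in `y`. -/
lemma intervalIntegrable_discrepancy (A : Set ℕ) (δ : ℝ) (b q : ℕ) {H x : ℝ} (hx : 0 ≤ x) :
    IntervalIntegrable (discrepancy A δ b q H) volume 0 x := by
  classical
  set s := (Finset.range (⌊x + H⌋₊ + 1)).filter fun n => n ∈ A ∧ n ≡ b [MOD q] with hs
  have h1 : IntervalIntegrable (fun y : ℝ => ∑ n ∈ s,
      (Set.Icc ((n : ℝ) - H) n).indicator (fun _ => (1 : ℝ)) y) volume 0 x := by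
    have h0 : ∀ n : ℕ, Integrable ((Set.Icc ((n : ℝ) - H) n).indicator fun _ => (1 : ℝ)) :=
      fun n => (integrable_indicator_iff measurableSet_Icc).2
        (integrableOn_const (by simp) (by simp))
    simpa only [Finset.sum_fn] using
      IntervalIntegrable.sum s fun n _ => (h0 n).intervalIntegrable (a := 0) (b := x)
  have h2 : IntervalIntegrable (fun y : ℝ => ((window A b q H y).ncard : ℝ)) volume 0 x := by
    refine h1.congr_uIoo fun y hy => ?_
    rw [Set.uIoo_of_le hx] at hy
    have hset : window A b q H y =
        (s.filter fun n => y ≤ (n : ℝ) ∧ (n : ℝ) ≤ y + H : Finset ℕ) := by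
      ext n
      simp only [window, Set.mem_inter_iff, Set.mem_ofPred_eq, hs, Finset.coe_filter,
        Finset.mem_filter, Finset.mem_range]
      constructor
      · rintro ⟨h1, h2, h3, h4⟩
        exact ⟨⟨Nat.lt_succ_of_le (Nat.le_floor (by linarith [hy.2])), h1, h4⟩, h2, h3⟩
      · rintro ⟨⟨-, h1, h4⟩, h2, h3⟩
        exact ⟨h1, h2, h3, h4⟩
    beta_reduce
    rw [hset, Set.ncard_coe_finset, Finset.card_filter, Nat.cast_sum]
    refine Finset.sum_congr rfl fun n _ => ?_
    simp only [Set.indicator_apply, Set.mem_Icc, sub_le_iff_le_add, and_comm]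
    split_ifs <;> simp
  exact ((h2.div_const H).sub intervalIntegrable_const).abs

lemma discrepancy_nonneg (A : Set ℕ) (δ : ℝ) (b q : ℕ) (H y : ℝ) : 0 ≤ discrepancy A δ b q H y :=
  abs_nonneg _

open Classical in
/-- The indicator function of a set of natural numbers, on the integers. -/
noncomputable def intInd (A : Set ℕ) (n : ℤ) : ℝ := if ∃ m ∈ A, (m : ℤ) = n then 1 else 0

lemma intInd_mem_Icc (A : Set ℕ) (n : ℤ) : intInd A n ∈ Set.Icc (0 : ℝ) 1 := by
  rw [intInd]; split_ifs <;> simp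

lemma abs_intInd_sub_le (A : Set ℕ) (n : ℤ) {δ : ℝ} (hδ : δ ∈ Set.Icc (0 : ℝ) 1) :
    |intInd A n - δ| ≤ 1 := by
  have h1 := intInd_mem_Icc A n
  rw [abs_le]
  constructor <;> linarith [h1.1, h1.2, hδ.1, hδ.2]

/-- For `y` strictly between `n - 1` and `n`, the window `[y, y + qJ]` contains exactly the terms
`n, n + q, …, n + (J - 1) q` of the progression through `n`. -/
lemma ncard_window_eq (A : Set ℕ) {q : ℕ} (hq : 1 ≤ q) (J n : ℕ) {y : ℝ}
    (hy : y ∈ Set.Ioo ((n : ℝ) - 1) n) :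
    ((window A (n % q) q ((q * J : ℕ) : ℝ) y).ncard : ℝ) =
      ∑ s ∈ Finset.range J, intInd A ((n : ℤ) + q * s) := by
  classical
  have hset : window A (n % q) q ((q * J : ℕ) : ℝ) y =
      (((Finset.range J).filter fun s => n + q * s ∈ A).image fun s => n + q * s : Finset ℕ) := by
    ext m
    simp only [window, Set.mem_inter_iff, Set.mem_ofPred_eq, Finset.coe_image, Finset.coe_filter,
      Set.mem_image, Finset.mem_range]
    constructor
    · rintro ⟨hmA, h1, h2, h3⟩
      have h4 : n ≤ m := by
        have : (n : ℝ) < m + 1 := by linarith [hy.1]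
        exact Nat.lt_succ_iff.1 (by exact_mod_cast this)
      have h5 : m < n + q * J := by
        have : (m : ℝ) < n + (q * J : ℕ) := by linarith [hy.2]
        exact_mod_cast this
      have h6 : n ≡ m [MOD q] := (h3.trans (Nat.mod_modEq n q)).symm
      obtain ⟨s, hs⟩ := (Nat.modEq_iff_dvd' h4).1 h6
      have h7 : m = n + q * s := by omega
      subst h7
      exact ⟨s, ⟨Nat.lt_of_mul_lt_mul_left (a := q) (by omega), hmA⟩, rfl⟩
    · rintro ⟨s, ⟨hs, hA⟩, rfl⟩
      have h1 : q * (s + 1) ≤ q * J := Nat.mul_le_mul_left q hs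
      have h2 : ((q * s : ℕ) : ℝ) + 1 ≤ (q * J : ℕ) := by
        have : q * s + 1 ≤ q * J := by rw [mul_add] at h1; omega
        exact_mod_cast this
      have h3 : (0 : ℝ) ≤ (q * s : ℕ) := by positivity
      refine ⟨hA, ?_, ?_, ?_⟩
      · rw [Nat.cast_add]; linarith [hy.2]
      · rw [Nat.cast_add]; linarith [hy.1]
      · simp [Nat.ModEq]
  rw [hset, Set.ncard_coe_finset, Finset.card_image_of_injOn, Finset.card_filter, Nat.cast_sum]
  · refine Finset.sum_congr rfl fun s _ => ?_
    have : (∃ m ∈ A, (m : ℤ) = (n : ℤ) + q * s) ↔ n + q * s ∈ A := by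
      constructor
      · rintro ⟨m, hm, h⟩
        have : m = n + q * s := by exact_mod_cast h
        rwa [← this]
      · intro h
        exact ⟨_, h, by push_cast; rfl⟩
    simp only [intInd, this]
    split_ifs <;> simp
  · intro a _ c _ h
    have : q * a = q * c := by simpa using h
    exact Nat.eq_of_mul_eq_mul_left (by omega) this

/-- The absolute value of the sum of the balanced indicator function over `J` consecutive
terms of a progression. -/
noncomputable def progSum (A : Set ℕ) (δ : ℝ) (q J : ℕ) (n : ℤ) : ℝ :=
  |∑ s ∈ Finset.range J, (intInd A (n + q * s) - δ)|

lemma progSum_nonneg (A : Set ℕ) (δ : ℝ) (q J : ℕ) (n : ℤ) : 0 ≤ progSum A δ q J n := abs_nonneg _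

lemma progSum_le (A : Set ℕ) {δ : ℝ} (hδ : δ ∈ Set.Icc (0 : ℝ) 1) (q J : ℕ) (n : ℤ) :
    progSum A δ q J n ≤ J := by
  refine (Finset.abs_sum_le_sum_abs _ _).trans
    ((Finset.sum_le_sum fun s _ => abs_intInd_sub_le A _ hδ).trans ?_)
  simp

lemma progSum_le_discrepancy (A : Set ℕ) (δ : ℝ) {q J : ℕ} (hq : 1 ≤ q) (hJ : 0 < J) (n : ℕ)
    {y : ℝ} (hy : y ∈ Set.Ioo ((n : ℝ) - 1) n) :
    progSum A δ q J n ≤ ((q * J : ℕ) : ℝ) *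
      ∑ b ∈ Finset.range q, discrepancy A δ b q ((q * J : ℕ) : ℝ) y := by
  have hq0 : (0 : ℝ) < q := by exact_mod_cast hq
  have hJ0 : (0 : ℝ) < J := by exact_mod_cast hJ
  have h1 := Finset.single_le_sum (fun b _ => discrepancy_nonneg A δ b q ((q * J : ℕ) : ℝ) y)
    (Finset.mem_range.2 (Nat.mod_lt n hq))
  refine le_trans (le_of_eq ?_) (mul_le_mul_of_nonneg_left h1 (by positivity))
  have hqJ : (0 : ℝ) < ((q * J : ℕ) : ℝ) := by push_cast; positivity
  rw [discrepancy, ncard_window_eq A hq J n hy, progSum, Finset.sum_sub_distrib,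
    ← abs_of_pos hqJ, ← abs_mul, abs_of_pos hqJ]
  congr 1
  simp only [Finset.sum_const, Finset.card_range, nsmul_eq_mul]
  push_cast
  field_simp

lemma sum_progSum_le (A : Set ℕ) (δ : ℝ) {q J : ℕ} (hq : 1 ≤ q) (hJ : 0 < J) {x : ℝ}
    (hx : 0 ≤ x) :
    ∑ n ∈ Finset.Icc 1 ⌊x⌋₊, progSum A δ q J n ≤ ((q * J : ℕ) : ℝ) *
      ∑ b ∈ Finset.range q, ∫ y in (0 : ℝ)..x, discrepancy A δ b q ((q * J : ℕ) : ℝ) y := by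
  set F : ℝ → ℝ := fun y => ((q * J : ℕ) : ℝ) *
    ∑ b ∈ Finset.range q, discrepancy A δ b q ((q * J : ℕ) : ℝ) y with hF
  have hF0 : ∀ y, 0 ≤ F y := fun y =>
    mul_nonneg (by positivity) (Finset.sum_nonneg fun b _ => discrepancy_nonneg _ _ _ _ _ _)
  have hint : ∀ z : ℝ, 0 ≤ z → IntervalIntegrable F volume 0 z := by
    intro z hz
    have := (IntervalIntegrable.sum (Finset.range q) fun b _ =>
      intervalIntegrable_discrepancy A δ b q (H := ((q * J : ℕ) : ℝ)) hz).const_mul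
        ((q * J : ℕ) : ℝ)
    simpa only [Finset.sum_apply] using this
  have hint' : ∀ n : ℕ, IntervalIntegrable F volume (n : ℝ) ((n + 1 : ℕ) : ℝ) := fun n =>
    (hint n (by positivity)).symm.trans (hint _ (by positivity))
  have h1 : ∀ n : ℕ, progSum A δ q J ((n + 1 : ℕ) : ℤ) ≤
      ∫ y in (n : ℝ)..((n + 1 : ℕ) : ℝ), F y := by
    intro n
    have h2 : ∫ _y in (n : ℝ)..((n + 1 : ℕ) : ℝ), progSum A δ q J ((n + 1 : ℕ) : ℤ) =
        progSum A δ q J ((n + 1 : ℕ) : ℤ) := by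
      rw [intervalIntegral.integral_const]
      push_cast
      simp
    rw [← h2]
    refine intervalIntegral.integral_mono_on_of_le_Ioo (by push_cast; linarith)
      intervalIntegrable_const (hint' n) fun y hy => ?_
    refine progSum_le_discrepancy A δ hq hJ (n + 1) ⟨?_, hy.2⟩
    push_cast
    linarith [hy.1]
  have h2 : ∑ n ∈ Finset.Icc 1 ⌊x⌋₊, progSum A δ q J n =
      ∑ n ∈ Finset.range ⌊x⌋₊, progSum A δ q J ((n + 1 : ℕ) : ℤ) := by
    rw [Finset.range_eq_Ico, Finset.sum_Ico_add' (fun n : ℕ => progSum A δ q J (n : ℤ)) 0 ⌊x⌋₊ 1]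
    rfl
  rw [h2]
  calc _ ≤ ∑ n ∈ Finset.range ⌊x⌋₊, ∫ y in (n : ℝ)..((n + 1 : ℕ) : ℝ), F y :=
        Finset.sum_le_sum fun n _ => h1 n
    _ = ∫ y in ((0 : ℕ) : ℝ)..(⌊x⌋₊ : ℝ), F y :=
        intervalIntegral.sum_integral_adjacent_intervals (a := fun n : ℕ => (n : ℝ))
          fun n _ => hint' n
    _ ≤ ∫ y in (0 : ℝ)..x, F y :=
        intervalIntegral.integral_mono_interval (by simp) (by simp) (Nat.floor_le hx)
          (Eventually.of_forall hF0) (hint x hx)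
    _ = _ := by
        rw [hF, intervalIntegral.integral_const_mul, intervalIntegral.integral_finsetSum]
        exact fun b _ => intervalIntegrable_discrepancy A δ b q hx

/-- The inner upper limit in the definition of uniform distribution in short intervals. -/
noncomputable def upperDiscrepancy (A : Set ℕ) (δ : ℝ) (b q : ℕ) (H : ℝ) : ℝ :=
  limsup (fun x : ℝ => (1 / x) * ∫ y in (0 : ℝ)..x, discrepancy A δ b q H y) atTop

lemma eventually_lt_upperDiscrepancy (A : Set ℕ) (δ : ℝ) (b q : ℕ) {H : ℝ} (hH : 0 < H)
    {ε : ℝ} (hε : 0 < ε) :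
    ∀ᶠ x : ℝ in atTop, (1 / x) * ∫ y in (0 : ℝ)..x, discrepancy A δ b q H y <
      upperDiscrepancy A δ b q H + ε := by
  refine eventually_lt_of_limsup_lt (lt_add_of_pos_right _ hε) ?_
  refine ⟨(H + 1) / H + |δ / q|, ?_⟩
  rw [eventually_map]
  filter_upwards [eventually_gt_atTop 0] with x hx
  have hbound : ∀ y ∈ Set.uIoc (0 : ℝ) x, ‖discrepancy A δ b q H y‖ ≤ (H + 1) / H + |δ / q| := by
    intro y hy
    rw [Set.uIoc_of_le hx.le] at hy
    rw [Real.norm_eq_abs, discrepancy, abs_abs]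
    refine (abs_sub _ _).trans (add_le_add ?_ le_rfl)
    rw [abs_of_nonneg (by positivity)]
    exact div_le_div_of_nonneg_right (ncard_window_le A b q hH.le hy.1.le) hH.le
  have h1 := (le_abs_self _).trans (intervalIntegral.norm_integral_le_of_norm_le_const hbound)
  rw [sub_zero, abs_of_pos hx] at h1
  rw [one_div, inv_mul_le_iff₀ hx]
  linarith

variable {U : Ultrafilter ℝ} (hU : (U : Filter ℝ) ≤ atTop)

lemma bdd_progSum (A : Set ℕ) {δ : ℝ} (hδ : δ ∈ Set.Icc (0 : ℝ) 1) (q J : ℕ) :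
    Bdd fun ω : ℝ × ℤ => progSum A δ q J ω.2 :=
  ⟨J, fun ω => by rw [abs_of_nonneg (progSum_nonneg _ _ _ _ _)]; exact progSum_le A hδ q J _⟩

lemma limMean_progSum_le (A : Set ℕ) {δ : ℝ} (hδ : δ ∈ Set.Icc (0 : ℝ) 1) {q J : ℕ} (hq : 1 ≤ q)
    (hJ : 0 < J) :
    limMean U hU (fun ω => progSum A δ q J ω.2) ≤ 2 * ((q * J : ℕ) : ℝ) *
      ∑ b ∈ Finset.range q, upperDiscrepancy A δ b q ((q * J : ℕ) : ℝ) := by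
  have hqJ : (0 : ℝ) < ((q * J : ℕ) : ℝ) := by
    exact_mod_cast Nat.mul_pos hq hJ
  have main : ∀ ε > 0, limMean U hU (fun ω => progSum A δ q J ω.2) ≤ 2 * ((q * J : ℕ) : ℝ) *
      ∑ b ∈ Finset.range q, (upperDiscrepancy A δ b q ((q * J : ℕ) : ℝ) + ε) := by
    intro ε hε
    refine le_of_tendsto (tendsto_limMean hU (bdd_progSum A hδ q J)) ?_
    have hev : ∀ᶠ x : ℝ in atTop, ∀ b ∈ Finset.range q,
        (1 / x) * ∫ y in (0 : ℝ)..x, discrepancy A δ b q ((q * J : ℕ) : ℝ) y <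
          upperDiscrepancy A δ b q ((q * J : ℕ) : ℝ) + ε := by
      rw [Filter.eventually_all_finset]
      exact fun b _ => eventually_lt_upperDiscrepancy A δ b q hqJ hε
    filter_upwards [hU hev, hU (eventually_ge_atTop (1 : ℝ))] with x hx hx1
    have hx0 : 0 < x := by linarith
    have hfl : 0 < ⌊x⌋₊ := Nat.floor_pos.2 hx1
    have hfl' : (1 : ℝ) ≤ ⌊x⌋₊ := by exact_mod_cast hfl
    -- The factor `2` absorbs the change of normalisation from `x` to `⌊x⌋₊`.
    have hfl2 : x ≤ 2 * ⌊x⌋₊ := by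
      have := Nat.lt_floor_add_one x
      linarith
    have h1 := sum_progSum_le A δ hq hJ hx0.le
    rw [intervalAvg, div_le_iff₀ (by linarith)]
    refine h1.trans ?_
    have h2 : ∑ b ∈ Finset.range q, ∫ y in (0 : ℝ)..x, discrepancy A δ b q ((q * J : ℕ) : ℝ) y ≤
        ∑ b ∈ Finset.range q, (upperDiscrepancy A δ b q ((q * J : ℕ) : ℝ) + ε) * x := by
      refine Finset.sum_le_sum fun b hb => ?_
      have := (hx b hb).le
      rw [one_div, inv_mul_le_iff₀ hx0] at this
      linarith
    rw [← Finset.sum_mul] at h2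
    have h3 : 0 ≤ ∑ b ∈ Finset.range q, (upperDiscrepancy A δ b q ((q * J : ℕ) : ℝ) + ε) := by
      refine Finset.sum_nonneg fun b hb => ?_
      refine le_trans ?_ (hx b hb).le
      exact mul_nonneg (by positivity) (intervalIntegral.integral_nonneg hx0.le
        fun y _ => discrepancy_nonneg _ _ _ _ _ _)
    calc _ ≤ ((q * J : ℕ) : ℝ) *
          ((∑ b ∈ Finset.range q, (upperDiscrepancy A δ b q ((q * J : ℕ) : ℝ) + ε)) * x) :=
          mul_le_mul_of_nonneg_left h2 hqJ.le
      _ ≤ ((q * J : ℕ) : ℝ) * ((∑ b ∈ Finset.range q,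
          (upperDiscrepancy A δ b q ((q * J : ℕ) : ℝ) + ε)) * (2 * ⌊x⌋₊)) := by gcongr
      _ = _ := by ring
  have hlim : Tendsto (fun ε : ℝ => 2 * ((q * J : ℕ) : ℝ) *
      ∑ b ∈ Finset.range q, (upperDiscrepancy A δ b q ((q * J : ℕ) : ℝ) + ε)) (𝓝[>] 0)
      (𝓝 (2 * ((q * J : ℕ) : ℝ) *
        ∑ b ∈ Finset.range q, (upperDiscrepancy A δ b q ((q * J : ℕ) : ℝ) + 0))) :=
    (Continuous.tendsto (by fun_prop) 0).mono_left nhdsWithin_le_nhds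
  simp only [add_zero] at hlim
  refine ge_of_tendsto hlim ?_
  filter_upwards [self_mem_nhdsWithin] with ε hε using main ε hε

/-- Uniform distribution in short intervals, in terms of sums over progressions. -/
lemma tendsto_limMean_progSum {A : Set ℕ} {δ : ℝ} (hδ : δ ∈ Set.Icc (0 : ℝ) 1)
    (hA : UniformInShortIntervals A δ) {q : ℕ} (hq : 1 ≤ q) :
    Tendsto (fun J : ℕ => limMean U hU (fun ω => progSum A δ q J ω.2) / J) atTop (𝓝 0) := by
  have h1 : ∀ b ∈ Finset.range q, Tendsto (fun J : ℕ => upperDiscrepancy A δ b q ((q * J : ℕ) : ℝ))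
      atTop (𝓝 0) := fun b _ => (hA b q hq).comp
    (tendsto_natCast_atTop_atTop.comp (tendsto_id.const_mul_atTop' hq))
  have h2 := (tendsto_finsetSum _ h1).const_mul (2 * (q : ℝ))
  rw [Finset.sum_const_zero, mul_zero] at h2
  refine squeeze_zero' (Eventually.of_forall fun J => div_nonneg ((limMean U hU).nonneg
    (bdd_progSum A hδ q J) fun ω => progSum_nonneg _ _ _ _ _) (by positivity)) ?_ h2
  filter_upwards [eventually_gt_atTop 0] with J hJ
  have hJ0 : (0 : ℝ) < J := by exact_mod_cast hJ
  rw [div_le_iff₀ hJ0]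
  refine (limMean_progSum_le hU A hδ hq hJ).trans (le_of_eq ?_)
  push_cast
  ring

/-- The multiples of `p` in the progression `n + q t`, `1 ≤ t ≤ H`, split into at most `p` blocks:
dividing out `p` yields progressions of difference `q` and length `H / p`. The at most `p` terms
left over contribute `p`. -/
lemma abs_sum_dvd_le (A : Set ℕ) {δ : ℝ} (hδ : δ ∈ Set.Icc (0 : ℝ) 1) (q : ℕ) {p : ℕ} (hp : 0 < p)
    (H : ℕ) (n : ℤ) :
    |∑ t ∈ Finset.Icc 1 H, if (p : ℤ) ∣ n + q * t then intInd A ((n + q * t) / p) - δ else 0| ≤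
      ∑ t ∈ Finset.range p, (if (p : ℤ) ∣ n + q * (t + 1 : ℕ) then
        progSum A δ q (H / p) ((n + q * (t + 1 : ℕ)) / p) else 0) + p := by
  set f : ℕ → ℝ := fun t => if (p : ℤ) ∣ n + q * (t + 1 : ℕ) then
    intInd A ((n + q * (t + 1 : ℕ)) / p) - δ else 0 with hf
  have hf1 : ∀ t, |f t| ≤ 1 := by
    intro t
    simp only [hf]
    split_ifs
    · exact abs_intInd_sub_le A _ hδ
    · simp
  have hp0 : (p : ℤ) ≠ 0 := by exact_mod_cast hp.ne'
  have h1 : ∑ t ∈ Finset.Icc 1 H,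
      (if (p : ℤ) ∣ n + q * t then intInd A ((n + q * t) / p) - δ else 0) =
      ∑ t ∈ Finset.range H, f t := by
    rw [Finset.range_eq_Ico, Finset.sum_Ico_add' (fun t : ℕ => if (p : ℤ) ∣ n + q * (t : ℤ) then
      intInd A ((n + q * (t : ℤ)) / p) - δ else 0) 0 H 1]
    rfl
  have h2 : ∀ J : ℕ, ∑ t ∈ Finset.range (p * J), f t = ∑ t ∈ Finset.range p,
      (if (p : ℤ) ∣ n + q * (t + 1 : ℕ) then
        ∑ s ∈ Finset.range J, (intInd A ((n + q * (t + 1 : ℕ)) / p + q * s) - δ) else 0) := by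
    intro J
    induction J with
    | zero => simp
    | succ J ih =>
      rw [mul_add, mul_one, Finset.sum_range_add, ih, ← Finset.sum_add_distrib]
      refine Finset.sum_congr rfl fun t _ => ?_
      have e : n + q * ((p * J + t + 1 : ℕ) : ℤ) = n + q * ((t + 1 : ℕ) : ℤ) + p * (q * J) := by
        push_cast; ring
      simp only [hf, e, dvd_add_left (dvd_mul_right (p : ℤ) _), Int.add_mul_ediv_left _ _ hp0,
        Finset.sum_range_succ]
      split_ifs <;> simp
  have h3 : H = p * (H / p) + H % p := (Nat.div_add_mod H p).symm
  have h4 : ∑ t ∈ Finset.range H, f t = ∑ t ∈ Finset.range (p * (H / p)), f t +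
      ∑ t ∈ Finset.range (H % p), f (p * (H / p) + t) := by
    conv_lhs => rw [h3, Finset.sum_range_add]
  rw [h1, h4, h2]
  refine (abs_add_le _ _).trans (add_le_add ?_ ?_)
  · refine (Finset.abs_sum_le_sum_abs _ _).trans (Finset.sum_le_sum fun t _ => ?_)
    split_ifs
    · exact le_rfl
    · simp
  · refine (Finset.abs_sum_le_sum_abs _ _).trans ((Finset.sum_le_sum fun t _ => hf1 _).trans ?_)
    simp only [Finset.sum_const, Finset.card_range, nsmul_eq_mul, mul_one]
    exact_mod_cast (Nat.mod_lt H hp).le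

/-- For a fixed prime `p`, the contribution of the multiples of `p` to the averages of the balanced
indicator function of a dilate along progressions tends to zero. -/
lemma tendsto_limMean_dvd {A : Set ℕ} {δ : ℝ} (hδ : δ ∈ Set.Icc (0 : ℝ) 1)
    (hA : UniformInShortIntervals A δ) {q p : ℕ} (hq : 1 ≤ q) (hp : 0 < p) :
    Tendsto (fun H : ℕ => limMean U hU fun ω => |∑ t ∈ Finset.Icc 1 H,
      if (p : ℤ) ∣ ω.2 + q * t then intInd A ((ω.2 + q * t) / p) - δ else 0| / H) atTop (𝓝 0) := by
  set M := limMean U hU with hM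
  have hinv : M.Invariant := limMean_invariant hU
  have hp0 : (0 : ℝ) < p := by exact_mod_cast hp
  have hb : ∀ H : ℕ, Bdd fun ω : ℝ × ℤ => |∑ t ∈ Finset.Icc 1 H,
      if (p : ℤ) ∣ ω.2 + q * t then intInd A ((ω.2 + q * t) / p) - δ else 0| := by
    intro H
    refine (Bdd.sum _ fun t _ => ⟨1, fun ω => ?_⟩).abs
    split_ifs
    · exact abs_intInd_sub_le A _ hδ
    · simp
  have hb1 : ∀ J : ℕ, Bdd fun ω : ℝ × ℤ =>
      if (p : ℤ) ∣ ω.2 then progSum A δ q J (ω.2 / p) else 0 := by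
    intro J
    refine ⟨J, fun ω => ?_⟩
    beta_reduce
    split_ifs
    · rw [abs_of_nonneg (progSum_nonneg _ _ _ _ _)]; exact progSum_le A hδ q J _
    · simp
  have hbound : ∀ H : ℕ, M (fun ω => |∑ t ∈ Finset.Icc 1 H,
      if (p : ℤ) ∣ ω.2 + q * t then intInd A ((ω.2 + q * t) / p) - δ else 0|) ≤
      p * M (fun ω => progSum A δ q (H / p) ω.2) + p := by
    intro H
    have hb2 : ∀ t ∈ Finset.range p, Bdd fun ω : ℝ × ℤ =>
        if (p : ℤ) ∣ ω.2 + q * (t + 1 : ℕ) then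
          progSum A δ q (H / p) ((ω.2 + q * (t + 1 : ℕ)) / p) else 0 := fun t _ =>
      (hb1 (H / p)).comp (tr (q * (t + 1 : ℕ)))
    have h1 := M.mono (hb H) ((Bdd.sum _ hb2).add (Bdd.const (p : ℝ)))
      fun ω => abs_sum_dvd_le A hδ q hp H ω.2
    rw [M.add (Bdd.sum _ hb2) (Bdd.const _), M.const, M.sum _ hb2] at h1
    refine h1.trans (add_le_add ?_ le_rfl)
    have h2 : ∀ t ∈ Finset.range p, M (fun ω => if (p : ℤ) ∣ ω.2 + q * (t + 1 : ℕ) then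
          progSum A δ q (H / p) ((ω.2 + q * (t + 1 : ℕ)) / p) else 0) ≤
          M (fun ω => progSum A δ q (H / p) ω.2) := fun t _ =>
      (hinv.map_tr (q * (t + 1 : ℕ)) (hb1 (H / p))).le.trans
        (limMean_dilate_le hU (bdd_progSum A hδ q (H / p))
          (fun ω => progSum_nonneg _ _ _ _ _) hp)
    refine (Finset.sum_le_sum h2).trans ?_
    simp
  have h1 := (tendsto_limMean_progSum hU hδ hA hq).comp (Nat.tendsto_div_const_atTop hp.ne')
  have h2 : Tendsto (fun H : ℕ => (p : ℝ) / H) atTop (𝓝 0) :=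
    tendsto_const_nhds.div_atTop tendsto_natCast_atTop_atTop
  have h3 := h1.add h2
  rw [add_zero] at h3
  refine squeeze_zero' (Eventually.of_forall fun H => M.nonneg ?_ fun ω => by positivity) ?_ h3
  · simpa only [div_eq_inv_mul] using (hb H).const_mul _
  · filter_upwards [eventually_ge_atTop p] with H hH
    have hH0 : (0 : ℝ) < H := by exact_mod_cast hp.trans_le hH
    have hJ0 : (0 : ℝ) < (H / p : ℕ) := by exact_mod_cast Nat.div_pos hH hp
    have hJH : (p : ℝ) * (H / p : ℕ) ≤ H := by exact_mod_cast Nat.mul_div_le H p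
    have hnn : 0 ≤ M (fun ω => progSum A δ q (H / p) ω.2) :=
      M.nonneg (bdd_progSum A hδ q _) fun ω => progSum_nonneg _ _ _ _ _
    simp only [div_eq_inv_mul _ (H : ℝ)]
    rw [M.const_mul _ (hb H), inv_mul_le_iff₀ hH0]
    refine (hbound H).trans ?_
    simp only [Function.comp]
    rw [mul_add, mul_inv_cancel_left₀ hH0.ne']
    refine add_le_add ?_ le_rfl
    rw [mul_div_assoc', le_div_iff₀ hJ0]
    nlinarith

/-- If the sets `B j x` correspond to the weakly stable set `A j`, and `A j` is uniformly
distributed in short intervals, then the averages of `B j x` along progressions tend to the density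
in mean. -/
theorem tendsto_limMean_progression {k : ℕ} {A : Fin k → Set ℕ} {B : Fin k → ℝ → Set ℕ}
    (hAB : ∀ j, Corresponds (B j) (A j)) {j : Fin k} {δ : ℝ} (hδ : δ ∈ Set.Icc (0 : ℝ) 1)
    (hA : UniformInShortIntervals (A j) δ) {q : ℕ} (hq : 1 ≤ q) :
    Tendsto (fun H : ℕ => limMean U hU fun ω => |(∑ t ∈ Finset.Icc 1 H,
      ((if dilLetter B (tr (q * t) ω) j = true then 1 else 0) - δ)) / H|) atTop (𝓝 0) := by
  classical
  set M := limMean U hU with hM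
  have hinv : M.Invariant := limMean_invariant hU
  set g : ℝ × ℤ → ℝ := fun ω => (if dilLetter B ω j = true then 1 else 0) - δ with hg
  have hg1 : ∀ ω, |g ω| ≤ 1 := by
    intro ω
    rw [abs_le]
    simp only [hg]
    constructor <;> split_ifs <;> linarith [hδ.1, hδ.2]
  refine tendsto_mean_abs_avg hinv hg1 (fun t => (q : ℤ) * t) 0 zero_le_one ?_
  intro p hp _ ε hε
  have h1 := (tendsto_limMean_dvd hU hδ hA hq hp.pos).eventually (gt_mem_nhds hε)
  filter_upwards [h1, eventually_gt_atTop 0] with H hH hH0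
  have hHr : (0 : ℝ) < H := by exact_mod_cast hH0
  -- The indicator of the multiples of `p` at which `B` differs from the dilate of `A`.
  set E : ℝ × ℤ → ℝ := fun ω =>
    if (p : ℤ) ∣ ω.2 ∧ dilLetter B ω ≠ letter A (ω.2 / p) then 1 else 0 with hE
  have hEb : Bdd E := Bdd.ite _
  have hdg : Bdd fun ω : ℝ × ℤ => if (p : ℤ) ∣ ω.2 then g ω else 0 :=
    ⟨1, fun ω => by beta_reduce; split_ifs; exacts [hg1 ω, by simp]⟩
  have hda : Bdd fun ω : ℝ × ℤ => if (p : ℤ) ∣ ω.2 then intInd (A j) (ω.2 / p) - δ else 0 :=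
    ⟨1, fun ω => by beta_reduce; split_ifs; exacts [abs_intInd_sub_le _ _ hδ, by simp]⟩
  have hdiv : ∀ {f : ℝ × ℤ → ℝ}, Bdd f → Bdd fun ω => f ω / H := fun hf => by
    simpa only [div_eq_inv_mul] using hf.const_mul _
  have hcmp : ∀ ω : ℝ × ℤ, |(if (p : ℤ) ∣ ω.2 then g ω else 0) -
      (if (p : ℤ) ∣ ω.2 then intInd (A j) (ω.2 / p) - δ else 0)| ≤ E ω := by
    intro ω
    by_cases hd : (p : ℤ) ∣ ω.2
    · rw [if_pos hd, if_pos hd]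
      by_cases hne : dilLetter B ω = letter A (ω.2 / p)
      · have : g ω = intInd (A j) (ω.2 / p) - δ := by
          simp only [hg, hne, letter, intInd, decide_eq_true_eq]
        rw [this, sub_self, abs_zero]
        simp only [hE]
        split_ifs <;> norm_num
      · have hE1 : E ω = 1 := if_pos ⟨hd, hne⟩
        rw [hE1]
        have h2 := intInd_mem_Icc (A j) (ω.2 / p)
        rw [abs_le]
        simp only [hg]
        constructor <;> split_ifs <;> linarith [h2.1, h2.2]
    · rw [if_neg hd, if_neg hd, sub_zero, abs_zero]
      simp only [hE]
      split_ifs <;> norm_num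
  have point : ∀ ω : ℝ × ℤ, |(∑ t ∈ Finset.Icc 1 H,
      if (p : ℤ) ∣ (tr ((q : ℤ) * t) ω).2 then g (tr ((q : ℤ) * t) ω) else 0) / H| ≤
      |∑ t ∈ Finset.Icc 1 H,
        if (p : ℤ) ∣ ω.2 + q * t then intInd (A j) ((ω.2 + q * t) / p) - δ else 0| / H +
      (∑ t ∈ Finset.Icc 1 H, E (tr ((q : ℤ) * t) ω)) / H := by
    intro ω
    rw [abs_div, abs_of_pos hHr, ← add_div]
    gcongr
    have h2 : |(∑ t ∈ Finset.Icc 1 H,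
        if (p : ℤ) ∣ (tr ((q : ℤ) * t) ω).2 then g (tr ((q : ℤ) * t) ω) else 0) -
        ∑ t ∈ Finset.Icc 1 H,
        if (p : ℤ) ∣ ω.2 + q * t then intInd (A j) ((ω.2 + q * t) / p) - δ else 0| ≤
        ∑ t ∈ Finset.Icc 1 H, E (tr ((q : ℤ) * t) ω) := by
      rw [← Finset.sum_sub_distrib]
      exact (Finset.abs_sum_le_sum_abs _ _).trans
        (Finset.sum_le_sum fun t _ => hcmp (tr ((q : ℤ) * t) ω))
    have h3 := abs_sub_abs_le_abs_sub (∑ t ∈ Finset.Icc 1 H,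
        if (p : ℤ) ∣ (tr ((q : ℤ) * t) ω).2 then g (tr ((q : ℤ) * t) ω) else 0)
        (∑ t ∈ Finset.Icc 1 H,
        if (p : ℤ) ∣ ω.2 + q * t then intInd (A j) ((ω.2 + q * t) / p) - δ else 0)
    linarith
  have hb0 : Bdd fun ω : ℝ × ℤ => |∑ t ∈ Finset.Icc 1 H,
      if (p : ℤ) ∣ ω.2 + q * t then intInd (A j) ((ω.2 + q * t) / p) - δ else 0| :=
    (Bdd.sum (Finset.Icc 1 H) fun (t : ℕ) _ => hda.comp (tr ((q : ℤ) * t))).abs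
  have hb1 := hdiv hb0
  have hb2 : Bdd fun ω : ℝ × ℤ => (∑ t ∈ Finset.Icc 1 H, E (tr ((q : ℤ) * t) ω)) / H :=
    hdiv (Bdd.sum _ fun t _ => hEb.comp (tr ((q : ℤ) * t)))
  have hb3 : Bdd fun ω : ℝ × ℤ => |(∑ t ∈ Finset.Icc 1 H,
      if (p : ℤ) ∣ (tr ((q : ℤ) * t) ω).2 then g (tr ((q : ℤ) * t) ω) else 0) / H| :=
    (hdiv (Bdd.sum (Finset.Icc 1 H) fun (t : ℕ) _ => hdg.comp (tr ((q : ℤ) * t)))).abs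
  refine (M.mono hb3 (hb1.add hb2) point).trans ?_
  rw [M.add hb1 hb2, add_comm]
  refine add_le_add ?_ hH.le
  simp only [div_eq_inv_mul _ (H : ℝ)]
  rw [M.const_mul _ (Bdd.sum _ fun (t : ℕ) _ => hEb.comp (tr ((q : ℤ) * t))),
    M.sum _ fun (t : ℕ) _ => hEb.comp (tr ((q : ℤ) * t)),
    Finset.sum_congr rfl fun (t : ℕ) _ => hinv.map_tr ((q : ℤ) * t) hEb]
  simp only [Finset.sum_const, Nat.card_Icc, add_tsub_cancel_right, nsmul_eq_mul]
  rw [inv_mul_cancel_left₀ hHr.ne']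
  exact limMean_ne_le hU hAB hp

end ShortIntervals

/-! ### Densities along an ultrafilter -/

section Density

lemma densityUpTo_nonneg (S : Set ℕ) {x : ℝ} (hx : 0 ≤ x) : 0 ≤ densityUpTo S x :=
  div_nonneg (by positivity) hx

lemma inter_Icc_eq (S : Set ℕ) [DecidablePred (· ∈ S)] {x : ℝ} (hx : 0 ≤ x) :
    S ∩ {n : ℕ | 1 ≤ n ∧ (n : ℝ) ≤ x} =
      ((Finset.Icc 1 ⌊x⌋₊).filter fun n => n ∈ S : Finset ℕ) := by
  ext n
  simp only [Set.mem_inter_iff, Set.mem_ofPred_eq, Finset.coe_filter, Finset.mem_Icc,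
    Nat.le_floor_iff hx]
  tauto

lemma densityUpTo_add_compl (S : Set ℕ) {x : ℝ} (hx : 0 ≤ x) :
    densityUpTo S x + densityUpTo Sᶜ x = ⌊x⌋₊ / x := by
  classical
  rw [densityUpTo, densityUpTo, inter_Icc_eq S hx, inter_Icc_eq Sᶜ hx, Set.ncard_coe_finset,
    Set.ncard_coe_finset, ← add_div]
  congr 1
  have := Finset.card_filter_add_card_filter_not (s := Finset.Icc 1 ⌊x⌋₊) fun n => n ∈ S
  rw [Nat.card_Icc, add_tsub_cancel_right] at this
  exact_mod_cast this

lemma densityUpTo_le_one (S : Set ℕ) {x : ℝ} (hx : 0 < x) : densityUpTo S x ≤ 1 := by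
  have h1 := densityUpTo_add_compl S hx.le
  have h2 := densityUpTo_nonneg Sᶜ hx.le
  have h3 : (⌊x⌋₊ : ℝ) / x ≤ 1 := (div_le_one hx).2 (Nat.floor_le hx.le)
  linarith

lemma HasDensity.compl {S : Set ℕ} (hS : HasDensity S 1) : HasDensity Sᶜ 0 := by
  have h : Tendsto (fun x : ℝ => (⌊x⌋₊ : ℝ) / x - densityUpTo S x) atTop (𝓝 (1 - 1)) :=
    tendsto_nat_floor_div_atTop.sub hS
  rw [sub_self] at h
  refine h.congr' ?_
  filter_upwards [eventually_ge_atTop 0] with x hx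
  linarith [densityUpTo_add_compl S hx]

/-- A set of lower density zero has density zero along some ultrafilter tending to infinity. -/
lemma exists_ultrafilter_of_lowerDensity {S : Set ℕ} (hS : lowerDensity S = 0) :
    ∃ U : Ultrafilter ℝ, (U : Filter ℝ) ≤ atTop ∧ Tendsto (densityUpTo S) U (𝓝 0) := by
  have hbdd : IsBoundedUnder (· ≤ ·) atTop (densityUpTo S) := by
    refine ⟨1, ?_⟩
    rw [eventually_map]
    filter_upwards [eventually_gt_atTop 0] with x hx using densityUpTo_le_one S hx
  refine mapClusterPt_iff_ultrafilter.1 (mapClusterPt_iff_frequently.2 fun s hs => ?_)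
  obtain ⟨ε, hε, hεs⟩ := Metric.mem_nhds_iff.1 hs
  have h1 : ∃ᶠ x in atTop, densityUpTo S x < ε :=
    frequently_lt_of_liminf_lt hbdd.isCoboundedUnder_ge (by rw [← hS] at hε; exact hε)
  refine (h1.and_eventually (eventually_ge_atTop 0)).mono fun x hx => hεs ?_
  rw [Metric.mem_ball, Real.dist_eq, sub_zero, abs_of_nonneg (densityUpTo_nonneg S hx.2)]
  exact hx.1

end Density

/-! ### The limiting system -/

section System

open scoped CompactlySupported in
/-- The distribution under a mean of a map to a compact space, as a Borel probability measure. -/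
lemma exists_measure_of_mean {Ω X : Type*} [TopologicalSpace X] [CompactSpace X] [T2Space X]
    [MeasurableSpace X] [BorelSpace X] (M : Mean Ω) (φ : Ω → X) :
    ∃ μ : Measure X, IsProbabilityMeasure μ ∧
      ∀ f : X → ℝ, Continuous f → ∫ x, f x ∂μ = M fun ω => f (φ ω) := by
  have hb : ∀ f : X → ℝ, Continuous f → Bdd fun ω => f (φ ω) := by
    intro f hf
    obtain ⟨C, hC⟩ := (isCompact_range hf.abs).bddAbove
    exact ⟨C, fun ω => hC ⟨φ ω, rfl⟩⟩
  let Λ : C_c(X, ℝ) →ₚ[ℝ] ℝ :=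
    { toFun := fun f => M fun ω => f (φ ω)
      map_add' := fun f g => M.add (hb f f.continuous) (hb g g.continuous)
      map_smul' := fun c f => M.const_mul c (hb f f.continuous)
      monotone' := fun f g hfg =>
        M.mono (hb f f.continuous) (hb g g.continuous) fun ω => hfg (φ ω) }
  have hΛ : ∀ f : X → ℝ, Continuous f →
      ∫ x, f x ∂(RealRMK.rieszMeasure Λ) = M fun ω => f (φ ω) := fun f hf =>
    RealRMK.integral_rieszMeasure Λ ⟨⟨f, hf⟩, HasCompactSupport.of_compactSpace f⟩
  refine ⟨RealRMK.rieszMeasure Λ, ⟨?_⟩, hΛ⟩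
  have h1 := hΛ (fun _ => 1) continuous_const
  rw [M.const, integral_const, smul_eq_mul, mul_one, measureReal_def] at h1
  exact (ENNReal.toReal_eq_one_iff _).1 h1

variable {k : ℕ}

/-- The left shift on two-sided sequences. -/
def shiftPerm (β : Type*) : Equiv.Perm (ℤ → β) where
  toFun x i := x (i + 1)
  invFun x i := x (i - 1)
  left_inv x := by simp
  right_inv x := by simp

lemma shiftPerm_zpow {β : Type*} (z : ℤ) (x : ℤ → β) (i : ℤ) :
    ((shiftPerm β) ^ z) x i = x (i + z) := by
  induction z generalizing x i with
  | zero => simp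
  | succ n ih =>
    rw [zpow_add_one, Equiv.Perm.mul_apply, ih]
    simp [shiftPerm, add_assoc]
  | pred n ih =>
    rw [zpow_sub_one, Equiv.Perm.mul_apply, ih]
    change x (i + -(n : ℤ) - 1) = _
    congr 1
    ring

/-- The sequence of letters of the sets `B j x` around `n`, for the position `(x, n)`. -/
noncomputable def itinerary (B : Fin k → ℝ → Set ℕ) (ω : ℝ × ℤ) : ℤ → Fin k → Bool :=
  fun i => dilLetter B (tr i ω)

lemma shiftPerm_itinerary (B : Fin k → ℝ → Set ℕ) (ω : ℝ × ℤ) :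
    shiftPerm _ (itinerary B ω) = itinerary B (tr 1 ω) := by
  funext i
  simp only [itinerary, shiftPerm, tr_tr, Equiv.coe_fn_mk, add_comm]

lemma continuous_shiftPerm {β : Type*} [TopologicalSpace β] : Continuous (shiftPerm β) :=
  continuous_pi fun i => continuous_apply (i + 1)

lemma continuous_shiftPerm_symm {β : Type*} [TopologicalSpace β] :
    Continuous (shiftPerm β).symm :=
  continuous_pi fun i => continuous_apply (i - 1)

/-- The distribution of the itinerary under an invariant mean is shift invariant. -/
lemma isSeparableSystem_of_mean {M : Mean (ℝ × ℤ)} (hM : M.Invariant) (B : Fin k → ℝ → Set ℕ)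
    {μ : Measure (ℤ → Fin k → Bool)} [IsProbabilityMeasure μ]
    (hμ : ∀ f : (ℤ → Fin k → Bool) → ℝ, Continuous f →
      ∫ x, f x ∂μ = M fun ω => f (itinerary B ω)) :
    IsSeparableSystem μ (shiftPerm (Fin k → Bool)) where
  isProbabilityMeasure := inferInstance
  measurePreserving := by
    have hT := (continuous_shiftPerm (β := Fin k → Bool)).measurable
    refine ⟨hT, ?_⟩
    have : IsProbabilityMeasure (μ.map (shiftPerm (Fin k → Bool))) :=
      Measure.isProbabilityMeasure_map hT.aemeasurable
    refine ext_of_forall_integral_eq_of_IsFiniteMeasure fun f => ?_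
    rw [integral_map hT.aemeasurable f.continuous.aestronglyMeasurable,
      hμ (fun x => f (shiftPerm _ x)) (f.continuous.comp continuous_shiftPerm),
      hμ f f.continuous]
    simp only [shiftPerm_itinerary]
    exact hM (fun ω => f (itinerary B ω)) ⟨‖f‖, fun ω => f.norm_coe_le_norm _⟩
  measurable_symm := continuous_shiftPerm_symm.measurable
  countablyGenerated := inferInstance

/-- The sequences whose letter at the origin contains `j`: the sets `B j` of the theorem. -/
def originSet (j : Fin k) : Set (ℤ → Fin k → Bool) := {x | x 0 j = true}

lemma ind_originSet_zpow (j : Fin k) (z : ℤ) (x : ℤ → Fin k → Bool) :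
    ind (originSet j) (((shiftPerm _) ^ z) x) = if x z j = true then 1 else 0 := by
  classical
  simp only [ind, originSet, Set.indicator_apply, Set.mem_ofPred_eq, shiftPerm_zpow, zero_add]

lemma continuous_letter_statistic (P : (Fin k → Bool) → Prop) [DecidablePred P] (z : ℤ) :
    Continuous fun x : ℤ → Fin k → Bool => if P (x z) then (1 : ℝ) else 0 :=
  (continuous_of_discreteTopology (f := fun v : Fin k → Bool => if P v then (1 : ℝ) else 0)).comp
    (continuous_apply z)

lemma continuous_ind_originSet_zpow (j : Fin k) (z : ℤ) :
    Continuous fun x : ℤ → Fin k → Bool => ind (originSet j) (((shiftPerm _) ^ z) x) := by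
  simp only [ind_originSet_zpow]
  exact continuous_letter_statistic (fun v => v j = true) z

end System

section Properties

variable {U : Ultrafilter ℝ} (hU : (U : Filter ℝ) ≤ atTop) {k : ℕ} {A : Fin k → Set ℕ}
  {B : Fin k → ℝ → Set ℕ}

open Classical in
/-- A property of letters that holds with density zero for the sets `A j` defines a null set of the
limiting system. -/
lemma measure_eq_zero_of_density (hAB : ∀ j, Corresponds (B j) (A j))
    {μ : Measure (ℤ → Fin k → Bool)} [IsProbabilityMeasure μ]
    (hμ : ∀ f : (ℤ → Fin k → Bool) → ℝ, Continuous f →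
      ∫ x, f x ∂μ = limMean U hU fun ω => f (itinerary B ω))
    (P : (Fin k → Bool) → Prop) {S : Set ℕ} (hS : HasDensity S 0)
    (hPS : ∀ n : ℕ, P (letter A n) → n ∈ S) : μ {x | P (x 0)} = 0 := by
  set ϕ : (Unit → Fin k → Bool) → ℝ := fun v => if P (v ()) then 1 else 0 with hϕ
  have hϕ01 : ∀ v, ϕ v ∈ Set.Icc (0 : ℝ) 1 := fun v => by
    simp only [hϕ]; split_ifs <;> simp
  have h0 : limMean U hU (fun ω => ϕ fun _ => letter A (ω.2 + 0)) = 0 := by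
    refine limMean_eq_zero_of_density hU (hS.mono_left hU)
      (fun ω => hϕ01 fun _ => letter A (ω.2 + 0)) fun x n hne => ?_
    refine hPS n ?_
    by_contra hP
    exact hne (by simp [hϕ, hP])
  have h1 : limMean U hU (fun ω => if P (dilLetter B ω) then 1 else 0) = 0 := by
    refine mean_eq_zero_of_primes (limMean_invariant hU)
      (fun ω => by split_ifs <;> simp) zero_le_one fun p hp => ?_
    have h2 := limMean_pattern_le hU hAB (fun _ : Unit => 0) hϕ01 hp
    rw [h0, zero_add, Fintype.card_unit, Nat.cast_one] at h2
    simpa [pattern, hϕ, tr] using h2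
  have h2 := hμ _ (continuous_letter_statistic P 0)
  have h3 : (fun ω => if P (itinerary B ω 0) then (1 : ℝ) else 0) =
      fun ω => if P (dilLetter B ω) then 1 else 0 := by
    funext ω
    simp [itinerary, tr]
  rw [h3, h1] at h2
  have hmeas : MeasurableSet {x : ℤ → Fin k → Bool | P (x 0)} :=
    (Set.toFinite {v : Fin k → Bool | P v}).measurableSet.preimage (measurable_pi_apply 0)
  have h4 : ∫ x : ℤ → Fin k → Bool, (if P (x 0) then (1 : ℝ) else 0) ∂μ =
      μ.real {x | P (x 0)} := by
    rw [← integral_indicator_one hmeas]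
    refine integral_congr_ae (Eventually.of_forall fun x => ?_)
    simp [Set.indicator_apply]
  rw [h4, measureReal_eq_zero_iff] at h2
  exact h2

/-- The averages of the sets of the limiting system along progressions. -/
lemma tendsto_integral_progression (hAB : ∀ j, Corresponds (B j) (A j))
    {μ : Measure (ℤ → Fin k → Bool)} [IsProbabilityMeasure μ]
    (hμ : ∀ f : (ℤ → Fin k → Bool) → ℝ, Continuous f →
      ∫ x, f x ∂μ = limMean U hU fun ω => f (itinerary B ω))
    {j : Fin k} {δ : ℝ} (hδ : δ ∈ Set.Icc (0 : ℝ) 1) (hA : UniformInShortIntervals (A j) δ)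
    {q : ℕ} (hq : 1 ≤ q) :
    Tendsto (fun H : ℕ => ∫ x, |Finset.expect (Finset.Icc 1 H) (fun t =>
      ind (originSet j) (((shiftPerm _) ^ (q * t)) x)) - δ| ∂μ) atTop (𝓝 0) := by
  refine (tendsto_limMean_progression hU hAB hδ hA hq).congr' ?_
  filter_upwards [eventually_gt_atTop 0] with H hH
  have hH0 : (H : ℝ) ≠ 0 := by positivity
  have hcast : ∀ (t : ℕ) (x : ℤ → Fin k → Bool), ((shiftPerm _) ^ (q * t)) x =
      ((shiftPerm _) ^ ((q : ℤ) * t)) x := by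
    intro t x
    rw [← zpow_natCast, Nat.cast_mul]
  simp only [Finset.expect_eq_sum_div_card, Nat.card_Icc, add_tsub_cancel_right, hcast]
  rw [hμ]
  · congr 1
    funext ω
    rw [Finset.sum_sub_distrib, sub_div]
    simp only [ind_originSet_zpow, itinerary, Finset.sum_const, Nat.card_Icc,
      add_tsub_cancel_right, nsmul_eq_mul]
    rw [mul_div_cancel_left₀ _ hH0]
    congr!
  · refine Continuous.abs (Continuous.sub (Continuous.div_const ?_ _) continuous_const)
    exact continuous_finsetSum _ fun t _ => continuous_ind_originSet_zpow j _

/-- The measure of a set is the limit in mean of its ergodic averages, if this limit is a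
constant. -/
lemma measure_originSet_eq {μ : Measure (ℤ → Fin k → Bool)}
    (hμ : IsSeparableSystem μ (shiftPerm (Fin k → Bool))) {j : Fin k} {δ : ℝ}
    (h : Tendsto (fun H : ℕ => ∫ x, |Finset.expect (Finset.Icc 1 H) (fun t =>
      ind (originSet j) (((shiftPerm _) ^ (1 * t)) x)) - δ| ∂μ) atTop (𝓝 0)) :
    μ (originSet j) = ENNReal.ofReal δ := by
  have := hμ.isProbabilityMeasure
  have hmeas : MeasurableSet (originSet j) :=
    (Set.toFinite {v : Fin k → Bool | v j = true}).measurableSet.preimage (measurable_pi_apply 0)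
  have hint : ∀ t : ℕ, Integrable (fun x : ℤ → Fin k → Bool =>
      ind (originSet j) (((shiftPerm _) ^ t) x)) μ := by
    intro t
    have hc := continuous_ind_originSet_zpow j (t : ℤ)
    simp only [zpow_natCast] at hc
    refine Integrable.of_bound hc.aestronglyMeasurable 1 (Eventually.of_forall fun x => ?_)
    rw [ind]
    exact (norm_indicator_le_norm_self _ _).trans (by simp)
  have hval : ∀ t : ℕ, ∫ x, ind (originSet j) (((shiftPerm _) ^ t) x) ∂μ =
      μ.real (originSet j) := by
    intro t
    have hpres : MeasurePreserving ((shiftPerm (Fin k → Bool)) ^ t : Equiv.Perm _) μ μ := by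
      rw [Equiv.Perm.coe_pow]
      exact hμ.measurePreserving.iterate t
    have h1 := integral_map (μ := μ) hpres.measurable.aemeasurable
      (f := ind (originSet j)) (by
        rw [hpres.map_eq]
        exact (measurable_const.indicator hmeas).aestronglyMeasurable)
    rw [hpres.map_eq] at h1
    rw [← h1, ← integral_indicator_one hmeas]
    rfl
  have hle : ∀ᶠ H : ℕ in atTop, |μ.real (originSet j) - δ| ≤
      ∫ x, |Finset.expect (Finset.Icc 1 H) (fun t =>
        ind (originSet j) (((shiftPerm _) ^ (1 * t)) x)) - δ| ∂μ := by
    filter_upwards [eventually_gt_atTop 0] with H hH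
    have hH0 : (H : ℝ) ≠ 0 := by positivity
    refine le_trans (le_of_eq ?_) abs_integral_le_integral_abs
    simp only [Finset.expect_eq_sum_div_card, Nat.card_Icc, add_tsub_cancel_right, one_mul]
    rw [integral_sub ((integrable_finsetSum _ fun t _ => hint t).div_const _)
      (integrable_const _), integral_div, integral_finsetSum _ fun t _ => hint t,
      Finset.sum_congr rfl fun t _ => hval t]
    simp [hH0]
  have h0 : |μ.real (originSet j) - δ| ≤ 0 := ge_of_tendsto h hle
  have h1 : μ.real (originSet j) = δ := sub_eq_zero.1 (abs_nonpos_iff.1 h0)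
  rw [← h1, ofReal_measureReal]

/-- The multiple averages of the limiting system along the primes, for a single intersection of
shifts of density zero along the ultrafilter. -/
lemma tendsto_primeLogAvg_integral (hAB : ∀ j, Corresponds (B j) (A j))
    {μ : Measure (ℤ → Fin k → Bool)}
    (hμ : ∀ f : (ℤ → Fin k → Bool) → ℝ, Continuous f →
      ∫ x, f x ∂μ = limMean U hU fun ω => f (itinerary B ω))
    {m : ℕ} (h : Fin m → ℤ) (c : Fin m → Fin k) {S : Set ℕ}
    (hS : Tendsto (densityUpTo S) U (𝓝 0)) (hsub : ⋂ i, shift (A (c i)) (h i) ⊆ S) :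
    Tendsto (fun P : ℕ => primeLogAvg P fun p =>
      ∫ x, ∏ i : Fin m, ind (originSet (c i)) (((shiftPerm _) ^ ((p : ℤ) * h i)) x) ∂μ)
      atTop (𝓝 0) := by
  classical
  set ϕ : (Fin m → Fin k → Bool) → ℝ := fun v =>
    ∏ i, if v i (c i) = true then 1 else 0 with hϕ
  have hϕ01 : ∀ v, ϕ v ∈ Set.Icc (0 : ℝ) 1 := fun v =>
    Bdd.prod_mem_Icc (F := fun i (v : Fin m → Fin k → Bool) =>
      if v i (c i) = true then (1 : ℝ) else 0) Finset.univ
      (fun i v => by split_ifs <;> simp) v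
  have h0 : limMean U hU (fun ω => ϕ fun i => letter A (ω.2 + h i)) = 0 := by
    refine limMean_eq_zero_of_density hU hS (fun ω => hϕ01 _) fun x n hne => hsub ?_
    simp only [hϕ, Finset.prod_ne_zero_iff] at hne
    refine Set.mem_iInter.2 fun i => ?_
    have h1 := hne i (Finset.mem_univ i)
    simp only [ne_eq, ite_eq_right_iff, one_ne_zero, imp_false, not_not, letter,
      decide_eq_true_eq] at h1
    exact h1
  have key := tendsto_primeLogAvg_pattern (dilLetter B) (h := h) (limMean_invariant hU) hϕ01
    (C := m) fun p hp => by
      have h1 := limMean_pattern_le hU hAB h hϕ01 hp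
      rw [h0, zero_add, Fintype.card_fin] at h1
      have hp0 : (0 : ℝ) < p := by exact_mod_cast hp.pos
      refine (mul_le_mul_of_nonneg_left h1 hp0.le).trans (le_of_eq ?_)
      field_simp
  refine key.congr fun P => ?_
  congr 1
  funext p
  rw [hμ]
  · congr 1
    funext ω
    simp only [pattern, hϕ, ind_originSet_zpow, itinerary]
    congr!
  · exact continuous_finsetProd _ fun i _ => continuous_ind_originSet_zpow (c i) _

end Properties

end WeakStable


open WeakStable in
theorem theorem2p2 {k : ℕ} (A : Fin k → Set ℕ) (hA : ∀ j, WeaklyStable (A j))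
    {I : Type*} [Fintype I] (m : I → ℕ)
    (h : (α : I) → Fin (m α) → ℤ) (c : (α : I) → Fin (m α) → Fin k)
    (hd : lowerDensity (⋃ α : I, ⋂ i : Fin (m α), shift (A (c α i)) (h α i)) = 0) :
    ∃ (X : Type) (_ : MeasurableSpace X) (μ : Measure X) (T : Equiv.Perm X)
      (B : Fin k → Set X),
      IsSeparableSystem μ T ∧
      (∀ j, MeasurableSet (B j)) ∧
      Tendsto (fun P : ℕ => ∑ α : I, primeLogAvg P (fun p =>
          ∫ x, ∏ i : Fin (m α), ind (B (c α i)) ((T ^ ((p : ℤ) * h α i)) x) ∂μ))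
        atTop (𝓝 0) ∧
      -- uniform distribution along progressions
      (∀ δ : Fin k → ℝ, (∀ j, δ j ∈ Set.Icc (0 : ℝ) 1) →
        (∀ j, UniformInShortIntervals (A j) (δ j)) →
        (∀ q : ℕ, 1 ≤ q → ∀ j,
          Tendsto (fun H : ℕ =>
              ∫ x, |Finset.expect (Finset.Icc 1 H) (fun t => ind (B j) ((T ^ (q * t)) x))
                - δ j| ∂μ) atTop (𝓝 0)) ∧
        (∀ j, μ (B j) = ENNReal.ofReal (δ j))) ∧
      -- disjointness
      ((∀ i j, i ≠ j → HasDensity (A i ∩ A j) 0) → ∀ i j, i ≠ j → μ (B i ∩ B j) = 0) ∧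
      -- covering
      (HasDensity (⋃ j, A j) 1 → μ (⋃ j, B j)ᶜ = 0) := by
  choose D hD using hA
  obtain ⟨U, hU, hS⟩ := exists_ultrafilter_of_lowerDensity hd
  obtain ⟨μ, hprob, hμ⟩ := exists_measure_of_mean (limMean U hU) (itinerary D)
  have hsys := isSeparableSystem_of_mean (limMean_invariant hU) D hμ
  refine ⟨ℤ → Fin k → Bool, inferInstance, μ, shiftPerm _, originSet, hsys, ?_, ?_, ?_, ?_, ?_⟩
  · exact fun j => (Set.toFinite {v : Fin k → Bool | v j = true}).measurableSet.preimage
      (measurable_pi_apply 0)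
  · have := tendsto_finsetSum (Finset.univ : Finset I) fun α _ =>
      tendsto_primeLogAvg_integral hU hD hμ (h α) (c α) hS (Set.subset_iUnion_of_subset α le_rfl)
    rwa [Finset.sum_const_zero] at this
  · intro δ hδ hunif
    have hprog : ∀ q : ℕ, 1 ≤ q → ∀ j, _ := fun q hq j =>
      tendsto_integral_progression hU hD hμ (hδ j) (hunif j) hq
    exact ⟨hprog, fun j => measure_originSet_eq hsys (hprog 1 le_rfl j)⟩
  · intro hdisj i j hij
    refine measure_eq_zero_of_density hU hD hμ (fun v => v i = true ∧ v j = true)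
      (hdisj i j hij) fun n hn => ?_
    exact ⟨(letter_natCast A n i).1 hn.1, (letter_natCast A n j).1 hn.2⟩
  · intro hcov
    have h0 := measure_eq_zero_of_density hU hD hμ (fun v => ∀ j, ¬ v j = true)
      hcov.compl fun n hn hmem => by
        obtain ⟨j, hj⟩ := Set.mem_iUnion.1 hmem
        exact hn j ((letter_natCast A n j).2 hj)
    convert h0 using 2
    ext x
    simp [originSet]
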